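/- Fix an integer $d\ge 1$. For $s\in[0,1)^d$ write $[0,s]=[0,s_1]\times\dots\times[0,s_d]$. Let $B([0,1)^d)$ be the set of bounded functions $g:[0,1)^d\to\mathbb R$ that are nondecreasing for the coordinatewise order and satisfy $g(0)=0$, with the metric of the sup-norm $\|g\|=\sup_{s\in[0,1)^d}|g(s)|$. Let $\mathfrak h(x)=x\log x-x+1$ for $x>0$, $\mathfrak h(0)=1$ and $\mathfrak h(x)=\infty$ for $x<0$. For $g\in B([0,1)^d)$ put $I(g)=\int_{[0,1)^d}\mathfrak h(g'(u))\,du$ if $g$ is absolutely continuous with respect to Lebesgue measure with derivative $g'$, that is, if $g'$ is integrable on $[0,1)^d$ and $g(s)=\int_{[0,s]}g'(u)\,du$ for all $s\in[0,1)^d$; put $I(g)=\infty$ otherwise. *Uniform large deviation principle.* Let $(m_n)$ be a sequence of nonnegative integers. Let $(X_{n,i})_{i\le m_n}$ be a triangular array of processes on a probability space whose paths almost surely lie in $B([0,1)^d)$, and let $(\epsilon_{n,i})_{i\le m_n}$ be numbers that are positive for all large $n$, with $\max_{i\le m_n}\epsilon_{n,i}\to0$. Let $J:B([0,1)^d)\to[0,\infty]$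 be a rate function, i.e. $\{J\le a\}$ is compact for every $0\le a<\infty$. The array $(X_{n,i})$ satisfies the ULDP in $(B([0,1)^d),\|\cdot\|)$ with speeds $\epsilon_{n,i}$ and rate function $J$ if, with $J(A)=\inf_{g\in A}J(g)$ ($\inf\emptyset=\infty$), $\log 0=-\infty$, and $\mathbb P_*,\mathbb P^*$ the inner and outer probabilities, $$\liminf_{n\to\infty}\ \min_{i\le m_n}\epsilon_{n,i}\log\mathbb P_*(X_{n,i}\in G)\ \ge\ -J(G)\quad\text{for every open } G\subset B([0,1)^d),$$ $$\limsup_{n\to\infty}\ \max_{i\le m_n}\epsilon_{n,i}\log\mathbb P^*(X_{n,i}\in F)\ \le\ -J(F)\quad\text{for every closed } F\subset B([0,1)^d).$$ (If $m_n=0$, the minimum is $\infty$ and the maximum is $-\infty$.) **Proposition.** Let $(Z_j)_{j\ge1}$ be i.i.d. random vectors in $\mathbb R^d$ having a density $f$ on an open set $O\subset\mathbb R^d$ (that is, $\mathbb P(Z_1\in A)=\int_A f$ for Borel $A\subset O$), where $f$ is continuous and strictly positive on $O$. Let $H\subset O$ be a compact set with nonempty interior. Let $c>0$ be finite and let $(h_n)_{n\ge1}$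 satisfy $0<h_n<1$, $h_n\downarrow0$, $nh_n\uparrow\infty$ and $nh_n/\log n\to c$. For each $n$ let $\eta_n$ be a Poisson random variable with expectation $n$, independent of $(Z_j)_{j\ge1}$, and set $$\Delta\Pi_n(z,h_n,s)=\frac{1}{c f(z)\log n}\sum_{j=1}^{\eta_n}1_{[0,s]}\!\left(\frac{Z_j-z}{h_n^{1/d}}\right),\qquad z\in H,\ s\in[0,1)^d,\ n\ge2 .$$ Then, for every triangular array $(z_{i,n})_{n\ge1,\,1\le i\le m_n}$ of elements of $H$, the array of processes $\Delta\Pi_n(z_{i,n},h_n,\cdot)$ satisfies the ULDP in $(B([0,1)^d),\|\cdot\|)$ with rate function $I$ and speeds $$\epsilon_{n,i}=\frac{1}{c\,f(z_{i,n})\log n}.$$ In particular, $I$ is a rate function. -/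

import Mathlib

open MeasureTheory ProbabilityTheory Filter Topology
open scoped ENNReal NNReal

noncomputable section

/-- The half-open unit cube `[0,1)^d`, as a product of half-open intervals.  Its order is the
coordinatewise order. -/
def unitCube (d : ℕ) : Set (Fin d → ℝ) :=
  Set.univ.pi fun _ => Set.Ico 0 1

/-- The origin belongs to the cube. -/
theorem zero_mem_unitCube (d : ℕ) : (0 : Fin d → ℝ) ∈ unitCube d :=
  fun _ _ => ⟨le_rfl, zero_lt_one⟩

/-- The cone `B([0,1)^d)` of bounded functions `g` on the cube that are nondecreasing for the
coordinatewise order and satisfy `g(0) = 0`.  It is a subset of the Banach space of all bounded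
functions on the cube with the sup-norm `‖g‖ = ⨆ s, |g s|`, and carries the induced topology. -/
def BCone (d : ℕ) : Set (lp (fun _ : unitCube d => ℝ) ∞) :=
  {g | Monotone (fun s => g s) ∧ g ⟨0, zero_mem_unitCube d⟩ = 0}

/-- The Chernoff function `h`. -/
def chernoff (x : ℝ) : ℝ≥0∞ :=
  if 0 < x then ENNReal.ofReal (x * Real.log x - x + 1) else if x = 0 then 1 else ⊤

/-- `φ` is a version of the derivative of `g` with respect to Lebesgue measure on the cube:
`g(s) = ∫_{[0,s]} φ` for all `s`.  The function `g` is absolutely continuous when such a `φ`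
exists, and `φ` is then unique up to a Lebesgue-null subset of the cube. -/
def IsLebesgueDerivative {d : ℕ} (g : BCone d) (φ : (Fin d → ℝ) → ℝ) : Prop :=
  IntegrableOn φ (unitCube d) ∧
    ∀ s : unitCube d, g.1 s = ∫ u in Set.Icc 0 (s : Fin d → ℝ), φ u

/-- The functional `I`: the integral of `h(g')` over the cube if `g` is absolutely continuous, and
`∞` otherwise.  All versions of `g'` give the same integral, so the infimum below runs over a set
with at most one value, and it is `∞` when there is no version at all. -/
def rateI {d : ℕ} (g : BCone d) : ℝ≥0∞ :=
  ⨅ (φ : (Fin d → ℝ) → ℝ) (_ : IsLebesgueDerivative g φ), ∫⁻ s in unitCube d, chernoff (φ s)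

/-- A rate function: a `[0,∞]`-valued function all of whose sublevel sets `{J ≤ a}`,
`0 ≤ a < ∞`, are compact. -/
def IsRateFunction {E : Type*} [TopologicalSpace E] (J : E → ℝ≥0∞) : Prop :=
  ∀ a : ℝ≥0, IsCompact {x | J x ≤ a}

/-- The inner probability of a (not necessarily measurable) set.  The outer probability of `S` is
`P S` itself, since Mathlib's measures are extended to all sets as outer measures. -/
def innerProb {Ω : Type*} [MeasurableSpace Ω] (P : Measure Ω) (S : Set Ω) : ℝ≥0∞ :=
  ⨆ (T : Set Ω) (_ : MeasurableSet T) (_ : T ⊆ S), P T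

/-- The event that the path of the process `X` is an element of `A ⊆ B([0,1)^d)`. -/
def pathIn {Ω : Type*} {d : ℕ} (X : Ω → unitCube d → ℝ) (A : Set (BCone d)) : Set Ω :=
  {ω | ∃ g ∈ A, ∀ s, g.1 s = X ω s}

/-- The uniform large deviation principle in `B([0,1)^d)` with the sup-norm, for a triangular
array `X n i`, `i < m n`, of processes on the cube, with speeds `ε n i` and rate function `J`. -/
structure ULDP {Ω : Type*} [MeasurableSpace Ω] (P : Measure Ω) {d : ℕ} (m : ℕ → ℕ)
    (X : (n : ℕ) → Fin (m n) → Ω → unitCube d → ℝ) (ε : (n : ℕ) → Fin (m n) → ℝ)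
    (J : BCone d → ℝ≥0∞) : Prop where
  /-- `J` is a rate function. -/
  rate : IsRateFunction J
  /-- The speeds are positive (for large `n`) and tend to `0` uniformly in `i`. -/
  speed : ∀ δ : ℝ, 0 < δ → ∀ᶠ n in atTop, ∀ i, 0 < ε n i ∧ ε n i < δ
  /-- Almost every path of each process is in the cone. -/
  path_mem : ∀ n i, ∀ᵐ ω ∂P, ω ∈ pathIn (X n i) Set.univ
  /-- The lower bound for open sets. -/
  lower : ∀ O : Set (BCone d), IsOpen O →
    -((⨅ g ∈ O, J g : ℝ≥0∞) : EReal) ≤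
      liminf (fun n => ⨅ i, (ε n i : EReal) * ENNReal.log (innerProb P (pathIn (X n i) O))) atTop
  /-- The upper bound for closed sets. -/
  upper : ∀ F : Set (BCone d), IsClosed F →
    limsup (fun n => ⨆ i, (ε n i : EReal) * ENNReal.log (P (pathIn (X n i) F))) atTop ≤
      -((⨅ g ∈ F, J g : ℝ≥0∞) : EReal)

/-- The poissonized increment `ΔΠ_n(z, h, s)` of the empirical distribution function, with `N` in
the role of the Poisson variable `η_n`, and `h` the bandwidth.  The sample is indexed from `0`. -/
def poissonIncrement {Ω : Type*} {d : ℕ} (Z : ℕ → Ω → Fin d → ℝ) (N : Ω → ℕ) (f : (Fin d → ℝ) → ℝ)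
    (c : ℝ) (n : ℕ) (z : Fin d → ℝ) (h : ℝ) (ω : Ω) (s : unitCube d) : ℝ :=
  (∑ i ∈ Finset.range (N ω),
      (Set.Icc (0 : Fin d → ℝ) s).indicator (fun _ => (1 : ℝ))
        ((h ^ (1 / (d : ℝ)))⁻¹ • (Z i ω - z))) /
    (c * f z * Real.log n)

end

/-! ### The Chernoff function: Young's inequality and uniform convexity. -/

open InformationTheory

/-! For a positive speed `ε`, the path at `s` is `ν([0,s])`, where `ν` puts mass `ε` on each
rescaled sample point. Cut the cube into `K ^ d` cells of volume `q = (K ^ d)⁻¹`. By thinning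
(`iIndepFun_sampleCount`, `map_sampleCount`) the cell counts are independent Poisson variables.
Continuity and positivity of `f` on the compact set `H` make their means asymptotic to `q / ε`,
uniformly over each row (`tendsto_speed_and_mean`). On the scale `1 / ε`, cell masses `x j`
therefore cost `∑ j, q * klFun (x j / q)`, the value of the functional at the density that is
constant on cells.

Finitely many cell masses control the sup-norm as follows. The cells that meet the boundary of
`[0,s]` lie in `d` slabs, so two distribution functions with nearly equal cell masses are close as
soon as one of the measures gives little mass to slabs (`abs_measureReal_Icc_sub_le`). Bounded
entropy forces this on a fine grid, by Young's inequality (`exists_grid_slab_sum_le`). The same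
estimate serves both bounds and the compactness of sublevel sets, and no separate exponential
tightness is needed.

Lower bound: prescribing the cell counts puts the path in the open set, and independence gives the
probability as a product of Poisson weights. Upper bound: a closed set with infimum above `a` is at
positive distance from the compact set `{rateI ≤ a}`, so on a fine grid the discrete entropy of each
distribution function in it exceeds `a` (`exists_grid_lt_sum_klFun`); an exponential Markov
inequality for that entropy concludes.

Sublevel sets are totally bounded by rounding cell masses. They are closed because `klFun` is
uniformly convex: near-minimizers among approximating densities are Cauchy in `L¹`, and Fatou's
lemma bounds the entropy of their limit. -/

theorem mul_le_klFun_add_exp {x : ℝ} (hx : 0 ≤ x) (l : ℝ) :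
    l * x ≤ klFun x + (Real.exp l - 1) := by
  rcases hx.eq_or_lt with rfl | hx
  · simp [klFun_zero, Real.exp_nonneg]
  · have h := Real.add_one_le_exp (l - Real.log x)
    rw [Real.exp_sub, Real.exp_log hx, le_div_iff₀ hx] at h
    rw [klFun_apply]
    linarith

theorem chernoff_of_nonneg {x : ℝ} (hx : 0 ≤ x) : chernoff x = ENNReal.ofReal (klFun x) := by
  rcases hx.eq_or_lt with rfl | hx
  · simp [chernoff, klFun_zero]
  · rw [chernoff, if_pos hx, klFun_apply]
    congr 1
    ring

theorem chernoff_of_neg {x : ℝ} (hx : x < 0) : chernoff x = ⊤ := by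
  rw [chernoff, if_neg hx.not_gt, if_neg hx.ne]

theorem ofReal_mul_sub_le_chernoff (l x : ℝ) :
    ENNReal.ofReal (l * x - (Real.exp l - 1)) ≤ chernoff x := by
  rcases le_or_gt 0 x with hx | hx
  · rw [chernoff_of_nonneg hx]
    exact ENNReal.ofReal_le_ofReal (by linarith [mul_le_klFun_add_exp hx l])
  · rw [chernoff_of_neg hx]
    exact le_top

theorem measurable_chernoff : Measurable chernoff := by
  have h : chernoff = fun x => if 0 ≤ x then ENNReal.ofReal (klFun x) else ⊤ := by
    ext x
    split_ifs with hx
    · rw [chernoff_of_nonneg hx]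
    · rw [chernoff_of_neg (not_le.1 hx)]
  rw [h]
  exact Measurable.ite measurableSet_Ici (measurable_klFun.ennreal_ofReal) measurable_const

/-- The parenthesis is `m * klFun (x / m)`. Young's inequality at `l = ±t` gives the bound, the
error being `exp l - 1 - l ≤ l ^ 2` for `|l| ≤ 1`. -/
theorem mul_abs_sub_le_klFun {x m t : ℝ} (hx : 0 ≤ x) (hm : 0 < m) (ht : 0 < t) (ht1 : t ≤ 1) :
    t * |x - m| ≤ (x * Real.log x - x * Real.log m - x + m) + t ^ 2 * m := by
  have key : ∀ l : ℝ, |l| = t →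
      l * (x - m) ≤ (x * Real.log x - x * Real.log m - x + m) + t ^ 2 * m := by
    intro l hl
    have h1 := mul_le_klFun_add_exp (div_nonneg hx hm.le) l
    have h2 := (abs_le.1 (Real.abs_exp_sub_one_sub_id_le (hl.trans_le ht1))).2
    rw [← sq_abs, hl] at h2
    have h3 : m * klFun (x / m) = x * Real.log x - x * Real.log m - x + m := by
      rw [klFun_apply]
      rcases hx.eq_or_lt with rfl | hx
      · simp
      · rw [Real.log_div hx.ne' hm.ne']
        field_simp
        ring
    have h4 : m * (l * (x / m)) = l * x := by field_simp
    have h5 := mul_le_mul_of_nonneg_left h1 hm.le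
    have h6 := mul_le_mul_of_nonneg_left h2 hm.le
    rw [mul_add, h3, h4] at h5
    linarith
  rcases abs_cases (x - m) with ⟨h, -⟩ | ⟨h, -⟩
  · rw [h]
    exact key t (abs_of_pos ht)
  · rw [h]
    have := key (-t) (by rw [abs_neg, abs_of_pos ht])
    linarith

/-- Uniform convexity of the Chernoff function with respect to the `L¹`-norm. -/
theorem klFun_add_klFun_sub_midpoint_ge {x y t : ℝ} (hx : 0 ≤ x) (hy : 0 ≤ y) (ht : 0 < t)
    (ht1 : t ≤ 1) :
    t * |x - y| - t ^ 2 * (x + y) ≤ klFun x + klFun y - 2 * klFun ((x + y) / 2) := by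
  rcases (add_nonneg hx hy).eq_or_lt with h0 | h0
  · have h1 : x = 0 := by linarith
    have h2 : y = 0 := by linarith
    subst h1 h2
    simp [klFun_zero]
    norm_num
  · have hm : 0 < (x + y) / 2 := by linarith
    have h1 := mul_abs_sub_le_klFun hx hm ht ht1
    have h2 := mul_abs_sub_le_klFun hy hm ht ht1
    have h3 : |x - y| ≤ |x - (x + y) / 2| + |y - (x + y) / 2| := by
      rw [abs_sub_comm y]
      convert! abs_add_le (x - (x + y) / 2) ((x + y) / 2 - y) using 2
      ring
    have h4 := mul_le_mul_of_nonneg_left h3 ht.le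
    simp only [klFun_apply]
    -- The entropies of `x` and `y` relative to their midpoint add up exactly to the convexity
    -- defect, since the linear terms cancel.
    have h5 : 2 * ((x + y) / 2 * Real.log ((x + y) / 2)) =
      x * Real.log ((x + y) / 2) + y * Real.log ((x + y) / 2) := by ring
    linarith

/-- Young's inequality for the Chernoff functional. -/
theorem mul_setIntegral_le_lintegral_chernoff {α : Type*} [MeasurableSpace α] {μ : Measure α}
    {A : Set α} (hA : μ A ≠ ⊤) {φ : α → ℝ} (hφ : IntegrableOn φ A μ)
    (hfin : ∫⁻ u in A, chernoff (φ u) ∂μ ≠ ⊤) (l : ℝ) :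
    l * ∫ u in A, φ u ∂μ ≤
      (∫⁻ u in A, chernoff (φ u) ∂μ).toReal + μ.real A * (Real.exp l - 1) := by
  have hi : Integrable (fun u => l * φ u - (Real.exp l - 1)) (μ.restrict A) :=
    (hφ.const_mul l).sub (integrableOn_const hA)
  have h1 : ∫ u in A, (l * φ u - (Real.exp l - 1)) ∂μ ≤
      (∫⁻ u in A, chernoff (φ u) ∂μ).toReal := by
    -- Only the positive part of the integrand matters, and it lies pointwise below `chernoff`.
    refine (integral_eq_lintegral_pos_part_sub_lintegral_neg_part hi).trans_le ?_
    refine (sub_le_self _ ENNReal.toReal_nonneg).trans ?_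
    exact ENNReal.toReal_mono hfin (lintegral_mono fun u => ofReal_mul_sub_le_chernoff _ _)
  rw [integral_sub (hφ.const_mul l) (integrableOn_const hA), integral_const_mul,
    setIntegral_const, smul_eq_mul] at h1
  linarith

theorem ae_nonneg_of_lintegral_chernoff_ne_top {α : Type*} [MeasurableSpace α] {μ : Measure α}
    {φ : α → ℝ} (hφ : AEMeasurable φ μ) (hfin : ∫⁻ u, chernoff (φ u) ∂μ ≠ ⊤) :
    ∀ᵐ u ∂μ, 0 ≤ φ u := by
  filter_upwards [ae_lt_top' (measurable_chernoff.comp_aemeasurable hφ) hfin] with u hu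
  by_contra h
  simp [chernoff_of_neg (not_le.1 h)] at hu

/-! ### Regular grids and comparison of distribution functions. -/

/-- The cells of the regular grid of mesh `1 / K` of the cube. -/
def gridCell {d : ℕ} (K : ℕ) (j : Fin d → Fin K) : Set (Fin d → ℝ) :=
  Set.univ.pi fun l => Set.Ico ((j l : ℝ) / K) (((j l : ℝ) + 1) / K)

section Grid

variable {d K : ℕ}

theorem measurableSet_gridCell (j : Fin d → Fin K) : MeasurableSet (gridCell K j) :=
  MeasurableSet.univ_pi fun _ => measurableSet_Ico

theorem volume_unitCube (d : ℕ) : volume (unitCube d) = 1 := by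
  simp [unitCube, Real.volume_pi_Ico]

theorem volume_real_unitCube (d : ℕ) : volume.real (unitCube d) = 1 := by
  simp [Measure.real, volume_unitCube]

instance isProbabilityMeasure_restrict_unitCube (d : ℕ) :
    IsProbabilityMeasure ((volume : Measure (Fin d → ℝ)).restrict (unitCube d)) :=
  ⟨by rw [Measure.restrict_apply_univ, volume_unitCube]⟩

theorem gridCell_subset_unitCube (j : Fin d → Fin K) : gridCell K j ⊆ unitCube d := by
  intro u hu l hl
  have h := hu l hl
  have hK : (0 : ℝ) < K := by
    have := (j l).pos
    exact_mod_cast this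
  have h1 : ((j l : ℝ) + 1) ≤ K := by exact_mod_cast (j l).isLt
  exact ⟨(by positivity : (0 : ℝ) ≤ (j l : ℝ) / K).trans h.1,
    h.2.trans_le ((div_le_one hK).2 h1)⟩

theorem volume_gridCell (hK : 0 < K) (j : Fin d → Fin K) :
    volume (gridCell K j) = ENNReal.ofReal (((K : ℝ) ^ d)⁻¹) := by
  have hK' : (0 : ℝ) < K := by exact_mod_cast hK
  have h : ∀ l, ((j l : ℝ) + 1) / K - (j l : ℝ) / K = (K : ℝ)⁻¹ := fun l => by ring
  rw [gridCell, Real.volume_pi_Ico, Finset.prod_congr rfl fun l _ => by rw [h l]]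
  simp [← ENNReal.ofReal_pow, hK'.le]

theorem volume_real_gridCell (hK : 0 < K) (j : Fin d → Fin K) :
    volume.real (gridCell K j) = ((K : ℝ) ^ d)⁻¹ := by
  rw [Measure.real, volume_gridCell hK, ENNReal.toReal_ofReal (by positivity)]

theorem lt_of_mem_gridCell_of_lt (hK : 0 < K) {i j : ℕ} {x y : ℝ} (hx : x < ((i : ℝ) + 1) / K)
    (hy : (j : ℝ) / K ≤ y) (hij : i < j) : x < y := by
  have hK' : (0 : ℝ) < K := by exact_mod_cast hK
  have : ((i : ℝ) + 1) / K ≤ j / K := by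
    gcongr
    exact_mod_cast hij
  linarith

theorem pairwise_disjoint_gridCell :
    Pairwise (Function.onFun Disjoint (gridCell (d := d) K)) := by
  intro i j hij
  refine Set.disjoint_left.2 fun u hi hj => hij ?_
  ext l
  have hK : 0 < K := (j l).pos
  have h1 := hi l trivial
  have h2 := hj l trivial
  by_contra hne
  rcases lt_or_gt_of_ne hne with h | h
  · exact (lt_of_mem_gridCell_of_lt hK h1.2 h2.1 h).false
  · exact (lt_of_mem_gridCell_of_lt hK h2.2 h1.1 h).false

theorem exists_mem_gridCell (hK : 0 < K) {s : Fin d → ℝ} (hs : s ∈ unitCube d) :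
    ∃ j, s ∈ gridCell K j := by
  have hK' : (0 : ℝ) < K := by exact_mod_cast hK
  have h0 : ∀ l, 0 ≤ s l * K := fun l => mul_nonneg (hs l trivial).1 hK'.le
  refine ⟨fun l => ⟨⌊s l * K⌋₊, (Nat.floor_lt (h0 l)).2 ?_⟩, fun l _ => ⟨?_, ?_⟩⟩
  · have := (hs l trivial).2
    nlinarith
  · rw [div_le_iff₀ hK']
    exact Nat.floor_le (h0 l)
  · rw [lt_div_iff₀ hK']
    exact Nat.lt_floor_add_one _

theorem iUnion_gridCell (hK : 0 < K) : ⋃ j, gridCell (d := d) K j = unitCube d :=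
  (Set.iUnion_subset gridCell_subset_unitCube).antisymm fun _ hs =>
    Set.mem_iUnion.2 (exists_mem_gridCell hK hs)

theorem Icc_zero_subset_unitCube {s : Fin d → ℝ} (hs : s ∈ unitCube d) :
    Set.Icc 0 s ⊆ unitCube d :=
  fun _ hu l _ => ⟨hu.1 l, (hu.2 l).trans_lt (hs l trivial).2⟩

/-- Cells strictly below the cell of `s` in every coordinate lie inside `[0,s]`. The companion bound
below covers `[0,s]` by the cells that are weakly below. -/
theorem sum_gridCell_le_measureReal_Icc (ν : Measure (Fin d → ℝ)) [IsFiniteMeasure ν]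
    {s : Fin d → ℝ} {k : Fin d → Fin K} (hk : s ∈ gridCell K k) :
    ∑ j with ∀ l, j l < k l, ν.real (gridCell K j) ≤ ν.real (Set.Icc 0 s) := by
  rw [← measureReal_biUnion_finset (fun i _ j _ hij => pairwise_disjoint_gridCell hij)
    (fun j _ => measurableSet_gridCell j)]
  refine measureReal_mono (Set.iUnion₂_subset fun j hj u hu => ⟨fun l => ?_, fun l => ?_⟩)
  · exact (gridCell_subset_unitCube j hu l trivial).1
  · exact (lt_of_mem_gridCell_of_lt (j l).pos (hu l trivial).2 (hk l trivial).1
      ((Finset.mem_filter.1 hj).2 l)).le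

theorem measureReal_Icc_le_sum_gridCell (ν : Measure (Fin d → ℝ)) [IsFiniteMeasure ν] (hK : 0 < K)
    {s : Fin d → ℝ} {k : Fin d → Fin K} (hk : s ∈ gridCell K k) :
    ν.real (Set.Icc 0 s) ≤ ∑ j with ∀ l, j l ≤ k l, ν.real (gridCell K j) := by
  rw [← measureReal_biUnion_finset (fun i _ j _ hij => pairwise_disjoint_gridCell hij)
    (fun j _ => measurableSet_gridCell j)]
  refine measureReal_mono (fun u hu => ?_) (measure_ne_top _ _)
  obtain ⟨j, hj⟩ := exists_mem_gridCell hK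
    (Icc_zero_subset_unitCube (gridCell_subset_unitCube k hk) hu)
  refine Set.mem_iUnion₂.2 ⟨j, Finset.mem_filter.2 ⟨Finset.mem_univ _, fun l => ?_⟩, hj⟩
  by_contra! h
  exact (lt_of_mem_gridCell_of_lt hK (hk l trivial).2 (hj l trivial).1 h).not_ge (hu.2 l)

/-- A cell that is weakly but not strictly below `k` shares some coordinate with `k`, hence lies in
one of the `d` slabs through `k`. -/
theorem sum_le_sum_lt_add (a : (Fin d → Fin K) → ℝ) (ha : ∀ j, 0 ≤ a j) {b : ℝ}
    (hb : ∀ l i, ∑ j with j l = i, a j ≤ b) (k : Fin d → Fin K) :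
    ∑ j with ∀ l, j l ≤ k l, a j ≤ (∑ j with ∀ l, j l < k l, a j) + d * b := by
  have h1 : ∀ j : Fin d → Fin K, (if ∀ l, j l ≤ k l then a j else 0) ≤
      (if ∀ l, j l < k l then a j else 0) + ∑ l, if j l = k l then a j else 0 := by
    intro j
    have h0 : ∀ l, 0 ≤ if j l = k l then a j else 0 := fun l => by
      split_ifs
      exacts [ha j, le_rfl]
    by_cases h : ∀ l, j l < k l
    · rw [if_pos h, if_pos fun l => (h l).le]
      exact le_add_of_nonneg_right (Finset.sum_nonneg fun l _ => h0 l)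
    · rw [if_neg h, zero_add]
      split_ifs with h2
      · push Not at h
        obtain ⟨l, hl⟩ := h
        refine le_trans ?_ (Finset.single_le_sum (fun l _ => h0 l) (Finset.mem_univ l))
        rw [if_pos (le_antisymm (h2 l) hl)]
      · exact Finset.sum_nonneg fun l _ => h0 l
  have h2 : ∑ l, ∑ j with j l = k l, a j ≤ d * b := by
    refine (Finset.sum_le_sum fun l _ => hb l (k l)).trans ?_
    simp
  refine le_trans ?_ (add_le_add_right h2 _)
  simp only [Finset.sum_filter]
  rw [Finset.sum_comm, ← Finset.sum_add_distrib]
  exact Finset.sum_le_sum fun j _ => h1 j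

/-- If two measures almost agree on the cells of a grid, and one of them gives little mass to each
slab of the grid, then their distribution functions are uniformly close. -/
theorem abs_measureReal_Icc_sub_le (hK : 0 < K) (ν₁ ν₂ : Measure (Fin d → ℝ)) [IsFiniteMeasure ν₁]
    [IsFiniteMeasure ν₂] {t b : ℝ}
    (ht : ∀ j, |ν₁.real (gridCell K j) - ν₂.real (gridCell K j)| ≤ t)
    (hb : ∀ l i, ∑ j with j l = i, ν₂.real (gridCell K j) ≤ b)
    {s : Fin d → ℝ} (hs : s ∈ unitCube d) :
    |ν₁.real (Set.Icc 0 s) - ν₂.real (Set.Icc 0 s)| ≤ (K : ℝ) ^ d * t + d * b := by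
  obtain ⟨k, hk⟩ := exists_mem_gridCell hK hs
  have ht0 : 0 ≤ t := (abs_nonneg _).trans (ht k)
  have hd := sum_le_sum_lt_add (fun j => ν₂.real (gridCell K j)) (fun j => measureReal_nonneg) hb k
  have hcard : ∀ S : Finset (Fin d → Fin K), (∑ _j ∈ S, t) ≤ (K : ℝ) ^ d * t := by
    intro S
    rw [Finset.sum_const, nsmul_eq_mul]
    gcongr
    have := Finset.card_le_univ S
    simp only [Fintype.card_pi, Fintype.card_fin, Finset.prod_const, Finset.card_univ] at this
    exact_mod_cast this
  have h1 : ∀ S : Finset (Fin d → Fin K), ∑ j ∈ S, ν₁.real (gridCell K j) ≤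
      (∑ j ∈ S, ν₂.real (gridCell K j)) + (K : ℝ) ^ d * t := by
    intro S
    refine le_trans ?_ (add_le_add_right (hcard S) _)
    rw [← Finset.sum_add_distrib]
    exact Finset.sum_le_sum fun j _ => by linarith [(abs_le.1 (ht j)).2]
  have h2 : ∀ S : Finset (Fin d → Fin K), ∑ j ∈ S, ν₂.real (gridCell K j) ≤
      (∑ j ∈ S, ν₁.real (gridCell K j)) + (K : ℝ) ^ d * t := by
    intro S
    refine le_trans ?_ (add_le_add_right (hcard S) _)
    rw [← Finset.sum_add_distrib]
    exact Finset.sum_le_sum fun j _ => by linarith [(abs_le.1 (ht j)).1]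
  have a1 := sum_gridCell_le_measureReal_Icc ν₁ hk
  have a2 := sum_gridCell_le_measureReal_Icc ν₂ hk
  have b1 := measureReal_Icc_le_sum_gridCell ν₁ hK hk
  have b2 := measureReal_Icc_le_sum_gridCell ν₂ hK hk
  have c1 := h1 (Finset.univ.filter fun j => ∀ l, j l ≤ k l)
  have c2 := h2 (Finset.univ.filter fun j => ∀ l, j l < k l)
  rw [abs_le]
  constructor <;> linarith

end Grid

/-! ### `L¹` limits of near-minimizers of the entropy. -/

section Completeness

variable {α : Type*} [MeasurableSpace α] {μ : Measure α}

/-- The parameter `t` stays free: a small convexity defect yields a small `L¹` distance once `t` is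
fixed small and the defect is small compared with `t`. -/
theorem integral_midpoint_klFun_ge {φ ψ : α → ℝ} (hφ0 : ∀ u, 0 ≤ φ u) (hψ0 : ∀ u, 0 ≤ ψ u)
    (hφ : Integrable φ μ) (hψ : Integrable ψ μ)
    (hφk : Integrable (fun u => klFun (φ u)) μ) (hψk : Integrable (fun u => klFun (ψ u)) μ)
    (hk : Integrable (fun u => klFun ((φ u + ψ u) / 2)) μ) {t : ℝ} (ht : 0 < t) (ht1 : t ≤ 1) :
    t * (∫ u, |φ u - ψ u| ∂μ) - t ^ 2 * ((∫ u, φ u ∂μ) + ∫ u, ψ u ∂μ) ≤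
      (∫ u, klFun (φ u) ∂μ) + (∫ u, klFun (ψ u) ∂μ) -
        2 * ∫ u, klFun ((φ u + ψ u) / 2) ∂μ := by
  rw [← integral_add hφ hψ, ← integral_const_mul, ← integral_const_mul, ← integral_const_mul,
    ← integral_add hφk hψk, ← integral_sub (f := fun u => t * |φ u - ψ u|)
      (g := fun u => t ^ 2 * (φ u + ψ u)) ((hφ.sub hψ).abs.const_mul _) ((hφ.add hψ).const_mul _),
    ← integral_sub (f := fun u => klFun (φ u) + klFun (ψ u))
      (g := fun u => 2 * klFun ((φ u + ψ u) / 2)) (hφk.add hψk) (hk.const_mul _)]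
  exact integral_mono (((hφ.sub hψ).abs.const_mul _).sub ((hφ.add hψ).const_mul _))
    ((hφk.add hψk).sub (hk.const_mul _))
    fun u => klFun_add_klFun_sub_midpoint_ge (hφ0 u) (hψ0 u) ht ht1

/-- Near-minimizers of the Chernoff functional over a decreasing sequence of midpoint convex sets
converge in `L¹`. -/
theorem exists_tendsto_of_midpoint_convex [IsFiniteMeasure μ] (A : ℕ → Set (α → ℝ)) (a : ℝ)
    (hanti : Antitone A) (hne : ∀ n, (A n).Nonempty)
    (hmid : ∀ n, ∀ φ ∈ A n, ∀ ψ ∈ A n, (fun u => (φ u + ψ u) / 2) ∈ A n)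
    (h0 : ∀ φ ∈ A 0, ∀ u, 0 ≤ φ u) (hint : ∀ φ ∈ A 0, Integrable φ μ)
    (hkint : ∀ φ ∈ A 0, Integrable (fun u => klFun (φ u)) μ)
    (hka : ∀ φ ∈ A 0, ∫ u, klFun (φ u) ∂μ ≤ a) :
    ∃ (ψ : ℕ → α → ℝ) (φ : α → ℝ), (∀ n, ψ n ∈ A n) ∧ Integrable φ μ ∧
      Tendsto (fun n => ∫ u, |ψ n u - φ u| ∂μ) atTop (𝓝 0) ∧
      ∫⁻ u, chernoff (φ u) ∂μ ≤ ENNReal.ofReal a := by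
  have hA0 : ∀ n, A n ⊆ A 0 := fun n => hanti (Nat.zero_le n)
  set E : (α → ℝ) → ℝ := fun φ => ∫ u, klFun (φ u) ∂μ with hE
  set c : ℕ → ℝ := fun n => sInf (E '' A n) with hc
  have hE0 : ∀ φ ∈ A 0, 0 ≤ E φ := fun φ hφ =>
    integral_nonneg fun u => klFun_nonneg (h0 φ hφ u)
  have hbdd : ∀ n, BddBelow (E '' A n) := fun n =>
    ⟨0, by rintro _ ⟨φ, hφ, rfl⟩; exact hE0 φ (hA0 n hφ)⟩
  have hcle : ∀ n, ∀ φ ∈ A n, c n ≤ E φ := fun n φ hφ =>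
    csInf_le (hbdd n) (Set.mem_image_of_mem E hφ)
  have hcmono : Monotone c := fun n m hnm =>
    csInf_le_csInf (hbdd n) ((hne m).image E) (Set.image_mono (hanti hnm))
  have hca : ∀ n, c n ≤ a := fun n => by
    obtain ⟨φ, hφ⟩ := hne n
    exact (hcle n φ hφ).trans (hka φ (hA0 n hφ))
  have hcbdd : BddAbove (Set.range c) := ⟨a, by rintro _ ⟨n, rfl⟩; exact hca n⟩
  have hclim := tendsto_atTop_ciSup hcmono hcbdd
  set C := ⨆ n, c n with hC
  have hcC : ∀ n, c n ≤ C := fun n => le_ciSup hcbdd n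
  have hex : ∀ n : ℕ, ∃ ψ ∈ A n, E ψ < c n + 1 / ((n : ℝ) + 1) := by
    intro n
    obtain ⟨_, ⟨ψ, hψ, rfl⟩, h⟩ := exists_lt_of_csInf_lt ((hne n).image E)
      (lt_add_of_pos_right (c n) (Nat.one_div_pos_of_nat (α := ℝ) (n := n)))
    exact ⟨ψ, hψ, h⟩
  choose ψ hψA hψE using hex
  have hψ0 := fun n => h0 _ (hA0 n (hψA n))
  have hψi := fun n => hint _ (hA0 n (hψA n))
  have hψk := fun n => hkint _ (hA0 n (hψA n))
  have hψa := fun n => hka _ (hA0 n (hψA n))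
  -- Young's inequality at `l = 1` bounds the `L¹` norms by `M`.
  set M := a + μ.real Set.univ * (Real.exp 1 - 1) with hM
  have hψM : ∀ n, ∫ u, ψ n u ∂μ ≤ M := by
    intro n
    have h1 : ∫ u, ψ n u ∂μ ≤ ∫ u, (klFun (ψ n u) + (Real.exp 1 - 1)) ∂μ :=
      integral_mono (hψi n) ((hψk n).add (integrable_const _)) fun u => by
        simpa using mul_le_klFun_add_exp (hψ0 n u) 1
    rw [integral_add (hψk n) (integrable_const _), integral_const, smul_eq_mul] at h1
    linarith [hψa n]
  have hM0 : 0 ≤ M := (integral_nonneg (hψ0 0)).trans (hψM 0)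
  -- The midpoint of `ψ m` and `ψ n` is still in `A n`, so its energy is at least `c n`, while both
  -- energies are at most `C + 1 / (n + 1)`.
  have hgap : ∀ n m, n ≤ m → ∀ t : ℝ, 0 < t → t ≤ 1 → t * ∫ u, |ψ m u - ψ n u| ∂μ ≤
      2 * (C - c n) + 2 * (1 / ((n : ℝ) + 1)) + t ^ 2 * (2 * M) := by
    intro n m hnm t ht ht1
    have hmem := hmid n _ (hanti hnm (hψA m)) _ (hψA n)
    have h1 := integral_midpoint_klFun_ge (hψ0 m) (hψ0 n) (hψi m) (hψi n) (hψk m) (hψk n)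
      (hkint _ (hA0 n hmem)) ht ht1
    have h2 := hcle n _ hmem
    have h3 := hψE n
    have h4 := hψE m
    have h5 : 1 / ((m : ℝ) + 1) ≤ 1 / ((n : ℝ) + 1) := Nat.one_div_le_one_div hnm
    have h6 := mul_le_mul_of_nonneg_left (add_le_add (hψM m) (hψM n)) (sq_nonneg t)
    simp only [hE] at h2 h3 h4
    linarith [hcC n, hcC m]
  have hdist : ∀ n m, dist ((hψi m).toL1 (ψ m)) ((hψi n).toL1 (ψ n)) =
      ∫ u, |ψ m u - ψ n u| ∂μ := by
    intro n m
    rw [dist_eq_norm, ← Integrable.toL1_sub, L1.norm_of_fun_eq_integral_norm]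
    rfl
  have hcauchy : CauchySeq fun n => (hψi n).toL1 (ψ n) := by
    refine Metric.cauchySeq_iff'.2 fun ε hε => ?_
    -- Fixed before `N`, so that the quadratic error is at most `t * (ε / 4)`; then `N` makes the
    -- gap less than `t * (ε / 4)`. The `M + 1` guards against `M = 0`.
    set t := min 1 (ε / (8 * (M + 1))) with ht
    have ht0 : 0 < t := lt_min one_pos (by positivity)
    have htM : t * (2 * M) ≤ ε / 4 := by
      have h1 : t * (2 * (M + 1)) ≤ ε / (8 * (M + 1)) * (2 * (M + 1)) := by
        gcongr
        exact min_le_right _ _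
      have h2 : ε / (8 * (M + 1)) * (2 * (M + 1)) = ε / 4 := by field_simp; norm_num
      nlinarith
    have hlim : Tendsto (fun n => 2 * (C - c n) + 2 * (1 / ((n : ℝ) + 1))) atTop (𝓝 0) := by
      have := ((tendsto_const_nhds (x := C)).sub hclim).const_mul 2 |>.add
        ((tendsto_one_div_add_atTop_nhds_zero_nat (𝕜 := ℝ)).const_mul 2)
      simpa using this
    obtain ⟨N, hN⟩ := (hlim.eventually_lt_const (show 0 < t * (ε / 4) by positivity)).exists
    refine ⟨N, fun n hn => ?_⟩
    rw [hdist]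
    have h := hgap N n hn t ht0 (min_le_left _ _)
    have h1 : t * ∫ u, |ψ n u - ψ N u| ∂μ < t * ε := by
      have : t ^ 2 * (2 * M) ≤ t * (ε / 4) := by
        rw [sq, mul_assoc]
        gcongr
      have : 0 < t * ε := by positivity
      linarith
    exact lt_of_mul_lt_mul_left h1 ht0.le
  obtain ⟨φL, hφL⟩ := cauchySeq_tendsto_of_complete hcauchy
  have hφi : Integrable φL μ := L1.integrable_coeFn φL
  have hL1 : Tendsto (fun n => ∫ u, |ψ n u - φL u| ∂μ) atTop (𝓝 0) := by
    have h := tendsto_iff_dist_tendsto_zero.1 hφL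
    refine h.congr fun n => ?_
    conv_lhs => rw [← Integrable.toL1_coeFn φL hφi]
    rw [dist_eq_norm, ← Integrable.toL1_sub, L1.norm_of_fun_eq_integral_norm]
    rfl
  refine ⟨ψ, φL, hψA, hφi, hL1, ?_⟩
  obtain ⟨ns, -, hns⟩ := (tendstoInMeasure_of_tendsto_Lp hφL).exists_seq_tendsto_ae
  have hae : ∀ᵐ u ∂μ, Tendsto (fun i => ψ (ns i) u) atTop (𝓝 (φL u)) := by
    have h1 : ∀ᵐ u ∂μ, ∀ n, ((hψi n).toL1 (ψ n)) u = ψ n u :=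
      ae_all_iff.2 fun n => (hψi n).coeFn_toL1
    filter_upwards [hns, h1] with u hu h1
    simpa only [h1] using hu
  -- Fatou's lemma along an almost everywhere convergent subsequence.
  calc ∫⁻ u, chernoff (φL u) ∂μ
      ≤ ∫⁻ u, liminf (fun i => ENNReal.ofReal (klFun (ψ (ns i) u))) atTop ∂μ := by
        refine lintegral_mono_ae ?_
        filter_upwards [hae] with u hu
        rw [chernoff_of_nonneg (ge_of_tendsto' hu fun i => hψ0 _ u)]
        refine le_of_eq (Tendsto.liminf_eq ?_).symm
        exact (ENNReal.continuous_ofReal.comp continuous_klFun).continuousAt.tendsto.comp hu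
    _ ≤ liminf (fun i => ∫⁻ u, ENNReal.ofReal (klFun (ψ (ns i) u)) ∂μ) atTop :=
        lintegral_liminf_le' fun i => (hψk _).aestronglyMeasurable.aemeasurable.ennreal_ofReal
    _ ≤ ENNReal.ofReal a := by
        refine liminf_le_of_le (by isBoundedDefault) fun b hb => ?_
        obtain ⟨i, hi⟩ := hb.exists
        refine hi.trans ?_
        rw [← ofReal_integral_eq_lintegral_ofReal (hψk _)
          (Eventually.of_forall fun u => klFun_nonneg (hψ0 _ u))]
        exact ENNReal.ofReal_le_ofReal (hψa _)

end Completeness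

/-! ### Compactness of the sublevel sets of the rate function. -/

section RateFunction

variable {d : ℕ}

theorem BCone.dist_le {g₁ g₂ : BCone d} {C : ℝ} (hC : 0 ≤ C)
    (h : ∀ s, |g₁.1 s - g₂.1 s| ≤ C) : dist g₁ g₂ ≤ C := by
  rw [Subtype.dist_eq, dist_eq_norm]
  exact lp.norm_le_of_forall_le hC fun s => by simpa using h s

theorem BCone.abs_sub_le_dist (g₁ g₂ : BCone d) (s : unitCube d) :
    |g₁.1 s - g₂.1 s| ≤ dist g₁ g₂ := by
  rw [Subtype.dist_eq, dist_eq_norm]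
  simpa using lp.norm_apply_le_norm ENNReal.top_ne_zero (g₁.1 - g₂.1) s

theorem BCone.continuous_apply (s : unitCube d) :
    Continuous fun g : lp (fun _ : unitCube d => ℝ) ∞ => g s := by
  refine LipschitzWith.continuous (K := 1) (LipschitzWith.of_dist_le_mul fun g₁ g₂ => ?_)
  rw [dist_eq_norm, dist_eq_norm, NNReal.coe_one, one_mul]
  simpa using lp.norm_apply_le_norm ENNReal.top_ne_zero (g₁ - g₂) s

theorem isClosed_BCone (d : ℕ) : IsClosed (BCone d) := by
  have h : BCone d = {g | ∀ s t, s ≤ t → g s ≤ g t} ∩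
      {g | g ⟨0, zero_mem_unitCube d⟩ = 0} := rfl
  rw [h]
  refine IsClosed.inter ?_ (isClosed_eq (BCone.continuous_apply _) continuous_const)
  simp only [Set.ofPred_forall]
  exact isClosed_iInter fun s => isClosed_iInter fun t => isClosed_iInter fun _ =>
    isClosed_le (BCone.continuous_apply s) (BCone.continuous_apply t)

instance completeSpace_BCone (d : ℕ) : CompleteSpace (BCone d) :=
  (isClosed_BCone d).completeSpace_coe

/-- The measure on the cube with density `φ`. -/
noncomputable def densityMeasure (φ : (Fin d → ℝ) → ℝ) : Measure (Fin d → ℝ) :=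
  (volume.restrict (unitCube d)).withDensity fun u => ENNReal.ofReal (φ u)

theorem isFiniteMeasure_densityMeasure {φ : (Fin d → ℝ) → ℝ} (hφ : IntegrableOn φ (unitCube d)) :
    IsFiniteMeasure (densityMeasure φ) :=
  isFiniteMeasure_withDensity_ofReal hφ.2

theorem densityMeasure_real {φ : (Fin d → ℝ) → ℝ} (hφ : IntegrableOn φ (unitCube d))
    (hφ0 : ∀ᵐ u ∂volume.restrict (unitCube d), 0 ≤ φ u) {A : Set (Fin d → ℝ)}
    (hA : MeasurableSet A) (hAc : A ⊆ unitCube d) :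
    (densityMeasure φ).real A = ∫ u in A, φ u := by
  rw [Measure.real, densityMeasure, withDensity_apply _ hA, Measure.restrict_restrict hA,
    Set.inter_eq_left.2 hAc,
    integral_eq_lintegral_of_nonneg_ae (ae_restrict_of_ae_restrict_of_subset hAc hφ0)
      (hφ.mono_set hAc).aestronglyMeasurable]

theorem IsLebesgueDerivative.apply_eq {g : BCone d} {φ : (Fin d → ℝ) → ℝ}
    (h : IsLebesgueDerivative g φ) (hφ0 : ∀ᵐ u ∂volume.restrict (unitCube d), 0 ≤ φ u)
    (s : unitCube d) : g.1 s = (densityMeasure φ).real (Set.Icc 0 s) := by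
  rw [h.2, densityMeasure_real h.1 hφ0 measurableSet_Icc (Icc_zero_subset_unitCube s.2)]

theorem exists_isLebesgueDerivative_of_rateI_lt {g : BCone d} {a : ℝ≥0∞} (h : rateI g < a) :
    ∃ φ, IsLebesgueDerivative g φ ∧ ∫⁻ s in unitCube d, chernoff (φ s) < a ∧
      ∀ᵐ u ∂volume.restrict (unitCube d), 0 ≤ φ u := by
  simp only [rateI, iInf_lt_iff] at h
  obtain ⟨φ, hφ, hlt⟩ := h
  exact ⟨φ, hφ, hlt, ae_nonneg_of_lintegral_chernoff_ne_top hφ.1.aemeasurable hlt.ne_top⟩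

theorem card_filter_apply_eq_mul {K : ℕ} (l : Fin d) (i : Fin K) :
    ((Finset.univ.filter fun j : Fin d → Fin K => j l = i).card : ℝ) * ((K : ℝ) ^ d)⁻¹ =
      (K : ℝ)⁻¹ := by
  have hK : (K : ℝ) ≠ 0 := by exact_mod_cast i.pos.ne'
  have h := Fintype.card_filter_piFinset_eq_of_mem (fun _ : Fin d => (Finset.univ : Finset (Fin K)))
    l (Finset.mem_univ i)
  simp only [Fintype.piFinset_univ, Finset.card_univ, Fintype.card_fin, Finset.prod_const,
    Finset.card_erase_of_mem (Finset.mem_univ l)] at h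
  rw [h]
  obtain ⟨e, rfl⟩ : ∃ e, d = e + 1 := ⟨d - 1, by have := l.pos; omega⟩
  rw [add_tsub_cancel_right, Nat.cast_pow, pow_succ]
  field_simp

/-- On fine grids, an array of cell masses with controlled entropy gives little mass to slabs. -/
theorem exists_grid_slab_sum_le (d : ℕ) {a δ : ℝ} (ha : 0 ≤ a) (hδ : 0 < δ) :
    ∃ K : ℕ, 0 < K ∧ ∀ x e : (Fin d → Fin K) → ℝ, (∀ j, 0 ≤ e j) →
      (∀ l j, l * x j ≤ e j + ((K : ℝ) ^ d)⁻¹ * (Real.exp l - 1)) → ∑ j, e j ≤ a →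
      ∀ l i, ∑ j with j l = i, x j ≤ δ := by
  -- Young's inequality is summed over a slab of volume `1 / K`. Since `K > exp t`, the exponential
  -- term contributes at most `1`, so `t` times the slab mass is at most `a + 1 = t * δ`.
  set t := (a + 1) / δ with ht
  have ht0 : 0 < t := by positivity
  obtain ⟨K, hK⟩ := exists_nat_gt (Real.exp t)
  have hK0 : (0 : ℝ) < K := (Real.exp_pos t).trans hK
  refine ⟨K, by exact_mod_cast hK0, fun x e he hx hea l i => ?_⟩
  have h1 : t * ∑ j with j l = i, x j ≤ a + 1 := by
    calc t * ∑ j with j l = i, x j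
        ≤ ∑ j with j l = i, (e j + ((K : ℝ) ^ d)⁻¹ * (Real.exp t - 1)) := by
          rw [Finset.mul_sum]
          exact Finset.sum_le_sum fun j _ => hx t j
      _ = (∑ j with j l = i, e j) + (K : ℝ)⁻¹ * (Real.exp t - 1) := by
          rw [Finset.sum_add_distrib, Finset.sum_const, nsmul_eq_mul, ← mul_assoc,
            card_filter_apply_eq_mul]
      _ ≤ a + 1 := by
          refine add_le_add ((Finset.sum_le_sum_of_subset_of_nonneg (Finset.filter_subset _ _)
            fun j _ _ => he j).trans hea) ?_
          rw [inv_mul_le_iff₀ hK0]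
          linarith
  have h2 : t * δ = a + 1 := by rw [ht]; field_simp
  rw [← h2] at h1
  exact le_of_mul_le_mul_left h1 ht0

theorem sum_lintegral_gridCell {K : ℕ} (hK : 0 < K) (F : (Fin d → ℝ) → ℝ≥0∞) :
    ∑ j, ∫⁻ u in gridCell K j, F u = ∫⁻ u in unitCube d, F u := by
  rw [← iUnion_gridCell hK, lintegral_iUnion measurableSet_gridCell pairwise_disjoint_gridCell,
    tsum_fintype]

theorem lintegral_gridCell_le {K : ℕ} (j : Fin d → Fin K) (F : (Fin d → ℝ) → ℝ≥0∞) :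
    ∫⁻ u in gridCell K j, F u ≤ ∫⁻ u in unitCube d, F u :=
  lintegral_mono_set (gridCell_subset_unitCube j)

theorem mul_setIntegral_gridCell_le {K : ℕ} (hK : 0 < K) (j : Fin d → Fin K)
    {φ : (Fin d → ℝ) → ℝ} (hφ : IntegrableOn φ (unitCube d))
    (hfin : ∫⁻ u in unitCube d, chernoff (φ u) ≠ ⊤) (l : ℝ) :
    l * ∫ u in gridCell K j, φ u ≤
      (∫⁻ u in gridCell K j, chernoff (φ u)).toReal + ((K : ℝ) ^ d)⁻¹ * (Real.exp l - 1) := by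
  rw [← volume_real_gridCell hK j]
  refine mul_setIntegral_le_lintegral_chernoff ?_ (hφ.mono_set (gridCell_subset_unitCube j))
    (ne_top_of_le_ne_top hfin (lintegral_gridCell_le j _)) l
  rw [volume_gridCell hK]
  exact ENNReal.ofReal_ne_top

theorem sum_toReal_lintegral_gridCell {K : ℕ} (hK : 0 < K) {F : (Fin d → ℝ) → ℝ≥0∞}
    (hfin : ∫⁻ u in unitCube d, F u ≠ ⊤) :
    ∑ j, (∫⁻ u in gridCell K j, F u).toReal = (∫⁻ u in unitCube d, F u).toReal := by
  rw [← sum_lintegral_gridCell hK, ENNReal.toReal_sum]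
  exact fun j _ => ne_top_of_le_ne_top hfin (lintegral_gridCell_le j _)

/-- Functions are classified by their cell masses rounded to multiples of a small `t`. The masses
are bounded, so there are finitely many classes, and the grid comparison bounds the diameter of
each. -/
theorem totallyBounded_rateI_le (a : ℝ≥0) : TotallyBounded {g : BCone d | rateI g ≤ a} := by
  refine Metric.totallyBounded_of_finite_discretization fun ε hε => ?_
  -- The slabs then cost `d * b ≤ ε / 4`, and the rounding `t` below costs another `ε / 4` over the
  -- `K ^ d` cells.
  set b : ℝ := ε / (4 * (d + 1)) with hb
  have hb0 : 0 < b := by positivity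
  obtain ⟨K, hK, hslab⟩ := exists_grid_slab_sum_le d (a := a + 1) (by positivity) hb0
  have hK' : (0 : ℝ) < K := by exact_mod_cast hK
  set t : ℝ := ε / (4 * K ^ d) with ht
  have ht0 : 0 < t := by positivity
  have hex : ∀ g : {g : BCone d | rateI g ≤ a}, ∃ φ, IsLebesgueDerivative g.1 φ ∧
      ∫⁻ s in unitCube d, chernoff (φ s) < (a : ℝ≥0∞) + 1 ∧
      ∀ᵐ u ∂volume.restrict (unitCube d), 0 ≤ φ u := fun g =>
    exists_isLebesgueDerivative_of_rateI_lt
      (lt_of_le_of_lt g.2 (ENNReal.lt_add_right ENNReal.coe_ne_top one_ne_zero))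
  choose φ hφ hφa hφ0 using hex
  have hfin : ∀ g, ∫⁻ s in unitCube d, chernoff (φ g s) ≠ ⊤ := fun g => (hφa g).ne_top
  have hreal : ∀ g, (∫⁻ s in unitCube d, chernoff (φ g s)).toReal ≤ a + 1 := fun g => by
    refine ENNReal.toReal_le_of_le_ofReal (by positivity) ((hφa g).le.trans_eq ?_)
    rw [ENNReal.ofReal_add (by positivity) zero_le_one]
    simp
  have hmass : ∀ g j, (densityMeasure (φ g)).real (gridCell K j) = ∫ u in gridCell K j, φ g u :=
    fun g j => densityMeasure_real (hφ g).1 (hφ0 g) (measurableSet_gridCell j)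
      (gridCell_subset_unitCube j)
  have hsum : ∀ g, ∑ j, (∫⁻ u in gridCell K j, chernoff (φ g u)).toReal ≤ a + 1 := fun g =>
    (sum_toReal_lintegral_gridCell hK (hfin g)).trans_le (hreal g)
  obtain ⟨M, hM⟩ := exists_nat_gt ((a + 1 + ((K : ℝ) ^ d)⁻¹ * (Real.exp 1 - 1)) / t)
  have hbound : ∀ g j, ⌊(∫ u in gridCell K j, φ g u) / t⌋₊ < M + 1 := by
    intro g j
    have h1 := mul_setIntegral_gridCell_le hK j (hφ g).1 (hfin g) 1
    rw [one_mul] at h1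
    have h2 := (Finset.single_le_sum (fun j _ => ENNReal.toReal_nonneg)
      (Finset.mem_univ j)).trans (hsum g)
    refine Nat.lt_succ_of_le (Nat.floor_le_of_le (le_trans ?_ hM.le))
    gcongr
    exact h1.trans (by gcongr)
  refine ⟨(Fin d → Fin K) → Fin (M + 1), inferInstance,
    fun g j => ⟨⌊(∫ u in gridCell K j, φ g u) / t⌋₊, hbound g j⟩, fun g₁ g₂ h => ?_⟩
  have hf₁ := isFiniteMeasure_densityMeasure (hφ g₁).1
  have hf₂ := isFiniteMeasure_densityMeasure (hφ g₂).1
  have hnn : ∀ g j, 0 ≤ (∫ u in gridCell K j, φ g u) / t := fun g j => by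
    rw [← hmass]
    positivity
  have hcell : ∀ j, |(densityMeasure (φ g₁)).real (gridCell K j) -
      (densityMeasure (φ g₂)).real (gridCell K j)| ≤ t := by
    intro j
    have h1 : ⌊(∫ u in gridCell K j, φ g₁ u) / t⌋₊ = ⌊(∫ u in gridCell K j, φ g₂ u) / t⌋₊ :=
      congrArg Fin.val (congrFun h j)
    have a1 := Nat.floor_le (hnn g₁ j)
    have a2 := Nat.lt_floor_add_one ((∫ u in gridCell K j, φ g₁ u) / t)
    have b1 := Nat.floor_le (hnn g₂ j)
    have b2 := Nat.lt_floor_add_one ((∫ u in gridCell K j, φ g₂ u) / t)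
    rw [h1] at a1 a2
    rw [hmass, hmass]
    rw [le_div_iff₀ ht0] at a1 b1
    rw [div_lt_iff₀ ht0] at a2 b2
    rw [abs_le]
    constructor <;> linarith
  have hsl : ∀ l i, ∑ j with j l = i, (densityMeasure (φ g₂)).real (gridCell K j) ≤ b := by
    refine hslab _ (fun j => (∫⁻ u in gridCell K j, chernoff (φ g₂ u)).toReal)
      (fun j => ENNReal.toReal_nonneg) (fun l j => ?_) (hsum g₂)
    rw [hmass]
    exact mul_setIntegral_gridCell_le hK j (hφ g₂).1 (hfin g₂) l
  have hle : (K : ℝ) ^ d * t + d * b ≤ ε / 2 := by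
    have h1 : (K : ℝ) ^ d * t = ε / 4 := by rw [ht]; field_simp
    have h2 : d * b ≤ ε / 4 := by
      rw [hb, mul_div_assoc', div_le_div_iff₀ (by positivity) (by positivity)]
      nlinarith
    linarith
  refine (BCone.dist_le (half_pos hε).le fun s => ?_).trans_lt (half_lt_self hε)
  rw [(hφ g₁).apply_eq (hφ0 g₁), (hφ g₂).apply_eq (hφ0 g₂)]
  exact (abs_measureReal_Icc_sub_le hK _ _ hcell hsl s.2).trans hle

/-- For `g` in the closure, the densities of entropy at most `a + η` whose distribution functions
are within `1 / (n + 1)` of `g` form decreasing, nonempty, midpoint convex sets. The `L¹` limit of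
near-minimizers is a derivative of `g`. -/
theorem isClosed_rateI_le (a : ℝ≥0) : IsClosed {g : BCone d | rateI g ≤ a} := by
  refine isClosed_of_closure_subset fun g hg => ?_
  refine ENNReal.le_of_forall_pos_le_add fun η hη _ => ?_
  set μ := (volume : Measure (Fin d → ℝ)).restrict (unitCube d) with hμ
  set b : ℝ := a + η with hb
  have hofb : ENNReal.ofReal b = a + η := by
    rw [hb, ENNReal.ofReal_add (NNReal.coe_nonneg _) (NNReal.coe_nonneg _),
      ENNReal.ofReal_coe_nnreal, ENNReal.ofReal_coe_nnreal]
  set A : ℕ → Set ((Fin d → ℝ) → ℝ) := fun n =>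
    {φ | (∀ u, 0 ≤ φ u) ∧ Integrable φ μ ∧ Integrable (fun u => klFun (φ u)) μ ∧
      ∫ u, klFun (φ u) ∂μ ≤ b ∧
      ∀ s : unitCube d, |g.1 s - ∫ u in Set.Icc 0 (s : Fin d → ℝ), φ u| ≤ 1 / ((n : ℝ) + 1)} with hA
  have hres : ∀ (s : unitCube d) {φ : (Fin d → ℝ) → ℝ}, Integrable φ μ →
      IntegrableOn φ (Set.Icc 0 (s : Fin d → ℝ)) volume := fun s φ h =>
    IntegrableOn.mono_set h (Icc_zero_subset_unitCube s.2)
  have hanti : Antitone A := fun n m hnm φ hφ =>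
    ⟨hφ.1, hφ.2.1, hφ.2.2.1, hφ.2.2.2.1, fun s =>
      (hφ.2.2.2.2 s).trans (Nat.one_div_le_one_div hnm)⟩
  have hne : ∀ n, (A n).Nonempty := by
    intro n
    obtain ⟨g', hg', hdist⟩ := Metric.mem_closure_iff.1 hg (1 / ((n : ℝ) + 1))
      Nat.one_div_pos_of_nat
    obtain ⟨φ, hφ, hφb, hφ0⟩ := exists_isLebesgueDerivative_of_rateI_lt
      (lt_of_le_of_lt (show rateI g' ≤ a from hg')
        (ENNReal.lt_add_right ENNReal.coe_ne_top (ENNReal.coe_ne_zero.2 hη.ne')))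
    -- Truncation makes nonnegativity hold everywhere rather than almost everywhere, as the sets `A
    -- n` demand.
    have hae : (fun u => max (φ u) 0) =ᵐ[μ] φ := by
      filter_upwards [hφ0] with u hu using max_eq_left hu
    have hi : Integrable (fun u => max (φ u) 0) μ := Integrable.congr hφ.1 hae.symm
    have hlt : ∫⁻ u, ENNReal.ofReal (klFun (max (φ u) 0)) ∂μ < ENNReal.ofReal b := by
      rw [hofb]
      refine lt_of_eq_of_lt (lintegral_congr_ae ?_) hφb
      filter_upwards [hφ0] with u hu
      rw [max_eq_left hu, chernoff_of_nonneg hu]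
    have hnn : ∀ u, 0 ≤ klFun (max (φ u) 0) := fun u => klFun_nonneg (le_max_right _ _)
    have hki : Integrable (fun u => klFun (max (φ u) 0)) μ :=
      (lintegral_ofReal_ne_top_iff_integrable
        (continuous_klFun.comp_aestronglyMeasurable hi.aestronglyMeasurable)
        (Eventually.of_forall hnn)).1 hlt.ne_top
    refine ⟨fun u => max (φ u) 0, fun u => le_max_right _ _, hi, hki, ?_, fun s => ?_⟩
    · rw [← ofReal_integral_eq_lintegral_ofReal hki (Eventually.of_forall hnn)] at hlt
      exact (ENNReal.ofReal_le_ofReal_iff (by positivity)).1 hlt.le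
    · have h1 : ∫ u in Set.Icc 0 (s : Fin d → ℝ), max (φ u) 0 =
          ∫ u in Set.Icc 0 (s : Fin d → ℝ), φ u :=
        integral_congr_ae (ae_restrict_of_ae_restrict_of_subset (Icc_zero_subset_unitCube s.2) hae)
      rw [h1, ← hφ.2]
      exact (BCone.abs_sub_le_dist g g' s).trans hdist.le
  have hmid : ∀ n, ∀ φ ∈ A n, ∀ ψ ∈ A n, (fun u => (φ u + ψ u) / 2) ∈ A n := by
    rintro n φ ⟨p0, p1, p2, p3, p4⟩ ψ ⟨q0, q1, q2, q3, q4⟩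
    have hconv : ∀ u, klFun ((φ u + ψ u) / 2) ≤ (klFun (φ u) + klFun (ψ u)) / 2 := by
      intro u
      have := convexOn_klFun.2 (p0 u) (q0 u) (show (0 : ℝ) ≤ 1 / 2 by norm_num)
        (show (0 : ℝ) ≤ 1 / 2 by norm_num) (by norm_num)
      simp only [smul_eq_mul] at this
      rw [show (φ u + ψ u) / 2 = 1 / 2 * φ u + 1 / 2 * ψ u by ring]
      linarith
    have hi : Integrable (fun u => (φ u + ψ u) / 2) μ := (p1.add q1).div_const 2
    have hnn : ∀ u, 0 ≤ (φ u + ψ u) / 2 := fun u => by linarith [p0 u, q0 u]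
    have hsum : Integrable (fun u => (klFun (φ u) + klFun (ψ u)) / 2) μ :=
      (p2.add q2).div_const 2
    have hki : Integrable (fun u => klFun ((φ u + ψ u) / 2)) μ := by
      refine hsum.mono' (continuous_klFun.comp_aestronglyMeasurable hi.aestronglyMeasurable)
        (Eventually.of_forall fun u => ?_)
      rw [Real.norm_of_nonneg (klFun_nonneg (hnn u))]
      exact hconv u
    refine ⟨hnn, hi, hki, ?_, fun s => ?_⟩
    · refine (integral_mono hki hsum hconv).trans ?_
      rw [integral_div, integral_add p2 q2]
      linarith
    · rw [integral_div, integral_add (hres s p1) (hres s q1)]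
      have h1 := abs_le.1 (p4 s)
      have h2 := abs_le.1 (q4 s)
      rw [abs_le]
      constructor <;> linarith [h1.1, h1.2, h2.1, h2.2]
  obtain ⟨ψ, φ, hψ, hφ, hlim, hφb⟩ := exists_tendsto_of_midpoint_convex (μ := μ) A b hanti hne hmid
    (fun φ hφ => hφ.1) (fun φ hφ => hφ.2.1) (fun φ hφ => hφ.2.2.1) (fun φ hφ => hφ.2.2.2.1)
  have hder : IsLebesgueDerivative g φ := by
    refine ⟨hφ, fun s => ?_⟩
    have hle : ∀ n : ℕ, |g.1 s - ∫ u in Set.Icc 0 (s : Fin d → ℝ), φ u| ≤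
        1 / ((n : ℝ) + 1) + ∫ u, |ψ n u - φ u| ∂μ := by
      intro n
      have h1 := (hψ n).2.2.2.2 s
      have hi := (hψ n).2.1.sub hφ
      have h2 : |(∫ u in Set.Icc 0 (s : Fin d → ℝ), ψ n u) -
          ∫ u in Set.Icc 0 (s : Fin d → ℝ), φ u| ≤ ∫ u, |ψ n u - φ u| ∂μ := by
        rw [← integral_sub (hres s (hψ n).2.1) (hres s hφ)]
        refine abs_integral_le_integral_abs.trans ?_
        exact setIntegral_mono_set (μ := volume) hi.abs
          (Eventually.of_forall fun u => abs_nonneg _)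
          (Icc_zero_subset_unitCube s.2).eventuallyLE
      refine (abs_sub_le _ (∫ u in Set.Icc 0 (s : Fin d → ℝ), ψ n u) _).trans ?_
      exact add_le_add h1 h2
    have hlim2 := (tendsto_one_div_add_atTop_nhds_zero_nat (𝕜 := ℝ)).add hlim
    rw [add_zero] at hlim2
    have := ge_of_tendsto' hlim2 hle
    exact sub_eq_zero.1 (abs_eq_zero.1 (this.antisymm (abs_nonneg _)))
  exact (iInf₂_le φ hder).trans (hφb.trans_eq hofb)

theorem isRateFunction_rateI (d : ℕ) : IsRateFunction (rateI (d := d)) := fun a =>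
  (totallyBounded_rateI_le a).isCompact_of_isClosed (isClosed_rateI_le a)

end RateFunction

/-! ### Poisson thinning of an i.i.d. sample. -/

section Thinning

variable {Ω E ι : Type*} [MeasurableSpace Ω] [MeasurableSpace E] {P : Measure Ω}
  [IsProbabilityMeasure P] {Z : ℕ → Ω → E} {N : Ω → ℕ} {r : ℝ≥0}

/-- The number of the first `N` sample points that fall into `C`. -/
noncomputable def sampleCount (Z : ℕ → Ω → E) (N : Ω → ℕ) (C : Set E) (ω : Ω) : ℕ :=
  ∑ i ∈ Finset.range (N ω), C.indicator (fun _ => (1 : ℕ)) (Z i ω)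

theorem measurable_sampleCount (hZ : ∀ j, Measurable (Z j)) (hN : Measurable N) {C : Set E}
    (hC : MeasurableSet C) : Measurable (sampleCount Z N C) := by
  have h : Measurable fun p : ℕ × Ω =>
      ∑ i ∈ Finset.range p.1, C.indicator (fun _ => (1 : ℕ)) (Z i p.2) :=
    measurable_from_prod_countable_right fun m =>
      Finset.measurable_sum (Finset.range m) fun i _ =>
        (measurable_const.indicator hC).comp (hZ i)
  exact h.comp (hN.prodMk measurable_id)

theorem integral_pow_poissonMeasure (r : ℝ≥0) (w : ℂ) :
    ∫ m, w ^ m ∂poissonMeasure r = Complex.exp (r * (w - 1)) := by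
  rw [integral_poissonMeasure]
  calc ∑' m : ℕ, (Real.exp (-r) * r ^ m / m.factorial) • w ^ m
      = ∑' m : ℕ, (Real.exp (-r) : ℂ) * ((r * w) ^ m / m.factorial) := by
        congr with m
        rw [Complex.real_smul, mul_pow]
        push_cast
        ring
    _ = Complex.exp (r * (w - 1)) := by
        rw [tsum_mul_left, (NormedSpace.expSeries_div_hasSum_exp (r * w)).tsum_eq,
          ← Complex.exp_eq_exp_ℂ, Complex.ofReal_exp, ← Complex.exp_add]
        push_cast
        ring_nf

/-- The generating functional of a Poisson number of i.i.d. sample points. -/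
theorem integral_prod_sample (hZ : ∀ j, Measurable (Z j)) (hZindep : iIndepFun Z P)
    (hZident : ∀ j, IdentDistrib (Z j) (Z 0) P P) (hN : Measurable N)
    (hNlaw : P.map N = poissonMeasure r) (hindep : IndepFun N (fun ω j => Z j ω) P)
    {F : E → ℂ} (hF : Measurable F) (hF1 : ∀ z, ‖F z‖ ≤ 1) :
    ∫ ω, ∏ k ∈ Finset.range (N ω), F (Z k ω) ∂P =
      Complex.exp (r * ((∫ ω, F (Z 0 ω) ∂P) - 1)) := by
  have hZm : Measurable fun ω j => Z j ω := measurable_pi_iff.2 hZ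
  have hG : Measurable fun p : ℕ × (ℕ → E) => ∏ k ∈ Finset.range p.1, F (p.2 k) :=
    measurable_from_prod_countable_right fun m =>
      Finset.measurable_prod (Finset.range m) fun k _ => hF.comp (measurable_pi_apply k)
  have hmap : P.map (fun ω => (N ω, fun j => Z j ω)) =
      (poissonMeasure r).prod (P.map fun ω j => Z j ω) := by
    rw [← hNlaw]
    exact (indepFun_iff_map_prod_eq_prod_map_map hN.aemeasurable hZm.aemeasurable).1 hindep
  have : IsProbabilityMeasure (P.map fun ω j => Z j ω) :=
    Measure.isProbabilityMeasure_map hZm.aemeasurable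
  -- For a fixed sample size the expectation factors; averaging over the Poisson size then gives its
  -- generating function.
  have hpow : ∀ m : ℕ, ∫ ω, ∏ k ∈ Finset.range m, F (Z k ω) ∂P = (∫ ω, F (Z 0 ω) ∂P) ^ m := by
    intro m
    have h := (hZindep.precomp (Fin.val_injective (n := m))).integral_fun_prod_comp
      (f := fun _ => F) (fun i => (hZ _).aemeasurable) (fun i => hF.aestronglyMeasurable)
    simp_rw [Finset.prod_range]
    rw [h]
    have h2 : ∀ i : ℕ, ∫ ω, F (Z i ω) ∂P = ∫ ω, F (Z 0 ω) ∂P := fun i =>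
      ((hZident i).comp hF).integral_eq
    simp [h2]
  calc ∫ ω, ∏ k ∈ Finset.range (N ω), F (Z k ω) ∂P
      = ∫ p, ∏ k ∈ Finset.range p.1, F (p.2 k) ∂P.map (fun ω => (N ω, fun j => Z j ω)) := by
        rw [integral_map (hN.prodMk hZm).aemeasurable hG.aestronglyMeasurable]
    _ = ∫ m, ∫ x, ∏ k ∈ Finset.range m, F (x k) ∂(P.map fun ω j => Z j ω) ∂poissonMeasure r := by
        rw [hmap, integral_prod]
        refine Integrable.of_bound hG.aestronglyMeasurable 1 (Eventually.of_forall fun p => ?_)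
        rw [norm_prod]
        exact Finset.prod_le_one (fun _ _ => norm_nonneg _) fun _ _ => hF1 _
    _ = ∫ m, (∫ ω, F (Z 0 ω) ∂P) ^ m ∂poissonMeasure r := by
        congr with m
        rw [← hpow, integral_map hZm.aemeasurable]
        exact (hG.comp measurable_prodMk_left).aestronglyMeasurable
    _ = _ := integral_pow_poissonMeasure _ _

variable [Fintype ι] {C : ι → Set E}

/-- The joint characteristic function of the counts already factors into Poisson ones, which yields
both their laws and their independence. -/
theorem integral_exp_sum_sampleCount (hZ : ∀ j, Measurable (Z j)) (hZindep : iIndepFun Z P)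
    (hZident : ∀ j, IdentDistrib (Z j) (Z 0) P P) (hN : Measurable N)
    (hNlaw : P.map N = poissonMeasure r) (hindep : IndepFun N (fun ω j => Z j ω) P)
    (hC : ∀ i, MeasurableSet (C i)) (hdisj : Pairwise (Function.onFun Disjoint C)) (t : ι → ℝ) :
    ∫ ω, Complex.exp (((∑ i, t i * sampleCount Z N (C i) ω : ℝ) : ℂ) * Complex.I) ∂P =
      ∏ i, Complex.exp (((r * (P.map (Z 0) (C i)).toNNReal : ℝ≥0) : ℝ) *
        (Complex.exp (t i * Complex.I) - 1)) := by
  set F : E → ℂ := fun z =>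
    Complex.exp (((∑ i, t i * (C i).indicator (fun _ => (1 : ℝ)) z : ℝ) : ℂ) * Complex.I) with hFdef
  have hF : Measurable F := by
    have : Measurable fun z => ∑ i, t i * (C i).indicator (fun _ => (1 : ℝ)) z :=
      Finset.measurable_sum _ fun i _ => (measurable_const.indicator (hC i)).const_mul _
    fun_prop
  have hF1 : ∀ z, ‖F z‖ ≤ 1 := fun z => (Complex.norm_exp_ofReal_mul_I _).le
  have hprod : ∀ ω, Complex.exp (((∑ i, t i * sampleCount Z N (C i) ω : ℝ) : ℂ) * Complex.I) =
      ∏ k ∈ Finset.range (N ω), F (Z k ω) := by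
    intro ω
    simp only [hFdef]
    rw [← Complex.exp_sum, ← Finset.sum_mul, ← Complex.ofReal_sum, Finset.sum_comm]
    congr 4 with i
    rw [← Finset.mul_sum, sampleCount]
    push_cast
    congr 2 with k
    by_cases h : Z k ω ∈ C i <;> simp [h]
  -- Disjointness enters here: at most one indicator is nonzero, so the exponential of the sum is
  -- linear in the indicators.
  have hFeq : ∀ z, F z = 1 + ∑ i, (C i).indicator
      (fun _ => Complex.exp (t i * Complex.I) - 1) z := by
    intro z
    by_cases h : ∃ i, z ∈ C i
    · obtain ⟨i, hi⟩ := h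
      have hne : ∀ j, j ≠ i → z ∉ C j := fun j hj hz =>
        Set.disjoint_left.1 (hdisj hj) hz hi
      simp only [hFdef]
      rw [Finset.sum_eq_single i (fun j _ hj => by simp [hne j hj]) (by simp),
        Finset.sum_eq_single i (fun j _ hj => by simp [hne j hj]) (by simp)]
      simp [hi]
    · push Not at h
      simp [hFdef, h]
  have hint : ∫ ω, F (Z 0 ω) ∂P =
      1 + ∑ i, ((P.map (Z 0) (C i)).toNNReal : ℝ) * (Complex.exp (t i * Complex.I) - 1) := by
    have hi : ∀ i, Integrable ((C i).indicator
        (fun _ => Complex.exp (t i * Complex.I) - 1)) (P.map (Z 0)) := fun i =>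
      (integrable_const _).indicator (hC i)
    have hpm : IsProbabilityMeasure (P.map (Z 0)) :=
      Measure.isProbabilityMeasure_map (hZ 0).aemeasurable
    rw [← integral_map (f := F) (hZ 0).aemeasurable hF.aestronglyMeasurable]
    simp_rw [hFeq]
    rw [integral_add (integrable_const _) (integrable_finsetSum _ fun i _ => hi i),
      integral_finsetSum _ fun i _ => hi i]
    simp only [integral_const, probReal_univ, one_smul, integral_indicator_const _ (hC _)]
    congr 2 with i
  simp_rw [hprod]
  rw [integral_prod_sample hZ hZindep hZident hN hNlaw hindep hF hF1, hint, ← Complex.exp_sum,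
    add_sub_cancel_left, Finset.mul_sum]
  congr with i
  push_cast
  ring

theorem map_sampleCount (hZ : ∀ j, Measurable (Z j)) (hZindep : iIndepFun Z P)
    (hZident : ∀ j, IdentDistrib (Z j) (Z 0) P P) (hN : Measurable N)
    (hNlaw : P.map N = poissonMeasure r) (hindep : IndepFun N (fun ω j => Z j ω) P)
    {A : Set E} (hA : MeasurableSet A) :
    P.map (sampleCount Z N A) = poissonMeasure (r * (P.map (Z 0) A).toNNReal) := by
  have hm := measurable_sampleCount hZ hN hA
  -- Characteristic functions live on `ℝ`; the embedding of `ℕ` loses no information.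
  apply (MeasurableEmbedding.natCast (α := ℝ)).map_injective
  have hpm : IsProbabilityMeasure (P.map (sampleCount Z N A)) :=
    Measure.isProbabilityMeasure_map hm.aemeasurable
  have hpm2 : IsProbabilityMeasure ((P.map (sampleCount Z N A)).map (Nat.cast : ℕ → ℝ)) :=
    Measure.isProbabilityMeasure_map (by fun_prop)
  apply Measure.ext_of_charFun
  ext t
  rw [charFun_map_cast_poissonMeasure, Measure.map_map (by fun_prop) hm, charFun_apply,
    integral_map (by fun_prop) (by fun_prop)]
  have h := integral_exp_sum_sampleCount (ι := Unit) (C := fun _ => A) hZ hZindep hZident hN hNlaw hindep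
    (fun _ => hA) (fun i j hij => (hij rfl).elim) (fun _ => t)
  simp only [Finset.univ_unique, Finset.sum_singleton, Finset.prod_singleton] at h
  refine Eq.trans (integral_congr_ae (Eventually.of_forall fun ω => ?_)) h
  simp [mul_comm]

/-- Thinning: the numbers of sample points in disjoint sets are independent. -/
theorem iIndepFun_sampleCount (hZ : ∀ j, Measurable (Z j)) (hZindep : iIndepFun Z P)
    (hZident : ∀ j, IdentDistrib (Z j) (Z 0) P P) (hN : Measurable N)
    (hNlaw : P.map N = poissonMeasure r) (hindep : IndepFun N (fun ω j => Z j ω) P)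
    (hC : ∀ i, MeasurableSet (C i)) (hdisj : Pairwise (Function.onFun Disjoint C)) :
    iIndepFun (fun i => sampleCount Z N (C i)) P := by
  have hm := fun i => measurable_sampleCount hZ hN (hC i)
  have hcast : iIndepFun (fun i ω => (sampleCount Z N (C i) ω : ℝ)) P := by
    rw [iIndepFun_iff_charFun_pi (fun i => by fun_prop)]
    intro t
    have hmarg : ∀ i, P.map (fun ω => (sampleCount Z N (C i) ω : ℝ)) =
        (poissonMeasure (r * (P.map (Z 0) (C i)).toNNReal)).map (Nat.cast : ℕ → ℝ) := fun i => by
      rw [← map_sampleCount hZ hZindep hZident hN hNlaw hindep (hC i),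
        Measure.map_map (by fun_prop) (hm i)]
      rfl
    simp_rw [hmarg, charFun_map_cast_poissonMeasure]
    rw [charFun_apply, integral_map (by fun_prop) (by fun_prop)]
    refine Eq.trans ?_ (integral_exp_sum_sampleCount hZ hZindep hZident hN hNlaw hindep hC hdisj t)
    congr with ω
  -- `Nat.floor` recovers the integer counts from their real casts.
  have := hcast.comp (fun _ => Nat.floor) (fun _ => Nat.measurable_floor)
  simpa [Function.comp_def] using this

end Thinning

/-! ### Large deviation estimates for single Poisson variables. -/

section PoissonAsymptotics

/-- A Stirling upper bound with logarithmic error, which the speed kills. The induction step is `(k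
+ 1) * log (k / (k + 1)) ≤ -1`. -/
theorem log_factorial_le {k : ℕ} (hk : 1 ≤ k) :
    Real.log k.factorial ≤ k * Real.log k - k + Real.log k + 1 := by
  induction k, hk using Nat.le_induction with
  | base => simp
  | succ k hk ih =>
    have hk0 : (0 : ℝ) < k := by exact_mod_cast hk
    have h1 := Real.log_le_sub_one_of_pos (show (0 : ℝ) < k / (k + 1) by positivity)
    rw [Real.log_div hk0.ne' (by positivity)] at h1
    have h2 : (k : ℝ) / (k + 1) - 1 = -(1 / (k + 1)) := by field_simp; ring
    have h3 := mul_le_mul_of_nonneg_left h1 (show (0 : ℝ) ≤ k + 1 by positivity)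
    have h4 : ((k : ℝ) + 1) * (k / (k + 1) - 1) = -1 := by field_simp; ring
    rw [Nat.factorial_succ, Nat.cast_mul, Real.log_mul (by positivity) (by positivity)]
    push_cast
    rw [h4] at h3
    linarith

theorem mul_klFun_div {q x : ℝ} (hq : 0 < q) (hx : 0 < x) :
    q * klFun (x / q) = x * (Real.log x - Real.log q) - x + q := by
  rw [klFun_apply, Real.log_div hx.ne' hq.ne']
  field_simp
  ring

theorem log_poissonMeasure_real_singleton {μ : ℝ≥0} (hμ : 0 < μ) (k : ℕ) :
    Real.log ((poissonMeasure μ).real {k}) =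
      -μ + k * Real.log μ - Real.log k.factorial := by
  have hμ' : (0 : ℝ) < μ := hμ
  rw [poissonMeasure_real_singleton, Real.log_div (by positivity) (by positivity),
    Real.log_mul (by positivity) (by positivity), Real.log_exp, Real.log_pow]

/-- Lower bound for the local large deviations of Poisson variables. -/
theorem eventually_le_mul_log_poissonMeasure {β : Type*} {l : Filter β} {ε : β → ℝ} {μ : β → ℝ≥0}
    {q x : ℝ} (hε : Tendsto ε l (𝓝[>] 0)) (hμ : Tendsto (fun b => ε b * μ b) l (𝓝 q)) (hq : 0 < q)
    (hx : 0 ≤ x) {r : ℝ} (hr : r < -(q * klFun (x / q))) :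
    ∀ᶠ b in l, 0 < μ b ∧ r ≤ ε b * Real.log ((poissonMeasure (μ b)).real {⌊x / ε b⌋₊}) := by
  have hε0 : Tendsto ε l (𝓝 0) := tendsto_nhds_of_tendsto_nhdsWithin hε
  have hεpos : ∀ᶠ b in l, 0 < ε b := hε.eventually (eventually_mem_nhdsWithin)
  have hμpos : ∀ᶠ b in l, 0 < μ b := by
    filter_upwards [hεpos, hμ.eventually_const_lt hq] with b h1 h2
    have : (0 : ℝ) < μ b := pos_of_mul_pos_right h2 h1.le
    exact_mod_cast this
  -- At `x = 0` the count is `0` and the weight is exactly `exp (-μ)`; the Stirling argument needs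
  -- `k ≥ 1`.
  rcases hx.eq_or_lt with rfl | hx
  · have h1 : Tendsto (fun b => -(ε b * μ b)) l (𝓝 (-q)) := hμ.neg
    rw [zero_div, klFun_zero, mul_one] at hr
    filter_upwards [hμpos, h1.eventually_const_lt hr] with b hb h2
    refine ⟨hb, ?_⟩
    rw [log_poissonMeasure_real_singleton hb]
    simp only [zero_div, Nat.floor_zero, Nat.cast_zero, zero_mul, Nat.factorial_zero,
      Nat.cast_one, Real.log_one]
    linarith
  · have hdiv : Tendsto (fun b => x / ε b) l atTop :=
      (tendsto_inv_nhdsGT_zero.comp hε).const_mul_atTop hx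
    have hk : Tendsto (fun b => ⌊x / ε b⌋₊) l atTop := tendsto_nat_floor_atTop.comp hdiv
    have hεk : Tendsto (fun b => ε b * ⌊x / ε b⌋₊) l (𝓝 x) := by
      have h := ((tendsto_nat_floor_div_atTop (R := ℝ)).comp hdiv).const_mul x
      rw [mul_one] at h
      refine h.congr' ?_
      filter_upwards [hεpos] with b hb
      simp only [Function.comp_apply]
      field_simp
    have hlogk : Tendsto (fun b => Real.log (⌊x / ε b⌋₊ : ℝ) / ⌊x / ε b⌋₊) l (𝓝 0) :=
      (Real.isLittleO_log_id_atTop.tendsto_div_nhds_zero.comp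
        tendsto_natCast_atTop_atTop).comp hk
    -- This is `ε` times the Stirling lower bound for the log-weight. Scaling both arguments of the
    -- difference of logarithms by `ε` leaves it unchanged and makes each converge.
    have hlim : Tendsto (fun b => -(ε b * μ b) + ε b * ⌊x / ε b⌋₊ *
        (Real.log (ε b * μ b) - Real.log (ε b * ⌊x / ε b⌋₊)) + ε b * ⌊x / ε b⌋₊ -
        ε b * ⌊x / ε b⌋₊ * (Real.log (⌊x / ε b⌋₊ : ℝ) / ⌊x / ε b⌋₊) - ε b) l
        (𝓝 (-q + x * (Real.log q - Real.log x) + x - x * 0 - 0)) :=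
      (((hμ.neg.add (hεk.mul ((hμ.log hq.ne').sub (hεk.log hx.ne')))).add hεk).sub
        (hεk.mul hlogk)).sub hε0
    have hval : -q + x * (Real.log q - Real.log x) + x - x * 0 - 0 = -(q * klFun (x / q)) := by
      rw [mul_klFun_div hq hx]
      ring
    rw [hval] at hlim
    filter_upwards [hμpos, hεpos, hk.eventually_ge_atTop 1, hlim.eventually_const_lt hr]
      with b hμb hεb hkb hb
    refine ⟨hμb, hb.le.trans ?_⟩
    have hμb' : (0 : ℝ) < μ b := hμb
    set k := ⌊x / ε b⌋₊
    have hk0 : (0 : ℝ) < k := by exact_mod_cast hkb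
    rw [log_poissonMeasure_real_singleton hμb, Real.log_mul hεb.ne' hμb'.ne',
      Real.log_mul hεb.ne' hk0.ne']
    have h1 := mul_le_mul_of_nonneg_left (log_factorial_le hkb) hεb.le
    have h2 : ε b * k * (Real.log k / k) = ε b * Real.log k := by field_simp
    rw [h2]
    linarith

/-- From `k! ≥ (k / e) ^ k`. The entropy is taken relative to a reference mean `M`, which will be
the same for all cells; the last two terms correct for the true mean. -/
theorem poissonMeasure_singleton_le {μ : ℝ≥0} {M : ℝ} (hμ : 0 < μ) (hM : 0 < M) (k : ℕ) :
    (poissonMeasure μ).real {k} ≤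
      Real.exp (-(M * klFun (k / M)) + k * Real.log (μ / M) + (M - μ)) := by
  have hμ' : (0 : ℝ) < μ := hμ
  rw [poissonMeasure_real_singleton]
  rcases k.eq_zero_or_pos with rfl | hk
  · simp [klFun_zero]
  · have hk0 : (0 : ℝ) < k := by exact_mod_cast hk
    have h1 := Real.pow_div_factorial_le_exp (k : ℝ) hk0.le k
    rw [mul_klFun_div hM hk0, Real.log_div hμ'.ne' hM.ne']
    have h2 : -(k * (Real.log k - Real.log M) - k + M) + k * (Real.log μ - Real.log M) + (M - μ) =
        -(μ : ℝ) + k * Real.log μ - k * Real.log k + k := by ring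
    have h3 : (μ : ℝ) ^ k / k.factorial ≤ μ ^ k / k ^ k * Real.exp k := by
      rw [div_mul_eq_mul_div, div_le_div_iff₀ (by positivity) (by positivity), mul_assoc]
      refine mul_le_mul_of_nonneg_left ?_ (by positivity)
      rwa [div_le_iff₀ (by positivity)] at h1
    rw [h2, Real.exp_add, Real.exp_sub, Real.exp_add, mul_comm (k : ℝ) (Real.log μ),
      mul_comm (k : ℝ) (Real.log k), Real.exp_mul, Real.exp_mul, Real.exp_log hμ', Real.exp_log hk0,
      Real.rpow_natCast, Real.rpow_natCast, mul_div_assoc, mul_div_assoc, mul_assoc]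
    exact mul_le_mul_of_nonneg_left h3 (by positivity)

/-- Exponential moments of the Chernoff function of a Poisson variable. -/
theorem lintegral_exp_klFun_poissonMeasure_le {μ : ℝ≥0} {M t : ℝ} (hμ : 0 < μ) (hM : 0 < M)
    (ht : 0 < t) (h1 : |Real.log (μ / M)| ≤ t) (h2 : |M - μ| ≤ t * M) :
    ∫⁻ k, ENNReal.ofReal (Real.exp ((1 - 2 * t) * (M * klFun (k / M)))) ∂poissonMeasure μ ≤
      ENNReal.ofReal (Real.exp (5 * t * M) * (1 - Real.exp (-t))⁻¹) := by
  rw [lintegral_countable']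
  have hterm : ∀ k : ℕ, ENNReal.ofReal (Real.exp ((1 - 2 * t) * (M * klFun (k / M)))) *
      poissonMeasure μ {k} ≤ ENNReal.ofReal (Real.exp (5 * t * M) * Real.exp (-t) ^ k) := by
    intro k
    rw [← ofReal_measureReal, ← ENNReal.ofReal_mul (Real.exp_nonneg _)]
    refine ENNReal.ofReal_le_ofReal ?_
    refine (mul_le_mul_of_nonneg_left (poissonMeasure_singleton_le hμ hM k)
      (Real.exp_nonneg _)).trans ?_
    rw [← Real.exp_add, ← Real.exp_nat_mul, ← Real.exp_add]
    refine Real.exp_le_exp.2 ?_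
    have hk : (0 : ℝ) ≤ k := Nat.cast_nonneg k
    -- Young's inequality gives `k ≤ M * klFun (k / M) + 2 * M`. The `2 * t` of entropy given up
    -- pays for `t * k` twice: once for the logarithmic correction, once for the geometric factor
    -- `exp (-t) ^ k`.
    have hy := mul_le_klFun_add_exp (div_nonneg hk hM.le) 1
    have he : Real.exp 1 - 1 ≤ 2 := by linarith [Real.exp_one_lt_d9]
    have hy2 : (k : ℝ) ≤ M * klFun (k / M) + 2 * M := by
      have := mul_le_mul_of_nonneg_left (hy.trans (add_le_add_right he _)) hM.le
      rw [one_mul, mul_div_cancel₀ _ hM.ne'] at this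
      linarith
    have ha := mul_le_mul_of_nonneg_left ((le_abs_self _).trans h1) hk
    have hb := (le_abs_self _).trans h2
    have hc := mul_le_mul_of_nonneg_left hy2 ht.le
    linarith
  have hgeo := hasSum_geometric_of_lt_one (Real.exp_nonneg (-t))
    (Real.exp_lt_one_iff.2 (neg_lt_zero.2 ht))
  refine (ENNReal.tsum_le_tsum hterm).trans_eq ?_
  rw [← ENNReal.ofReal_tsum_of_nonneg (fun k => by positivity) (hgeo.mul_left _).summable,
    (hgeo.mul_left _).tsum_eq]

end PoissonAsymptotics

/-! ### Local intensity of the sample, uniformly over `H`. -/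

section LocalIntensity

variable {d : ℕ}

/-- The local coordinate around `z` at scale `r`. -/
noncomputable def rescale (z : Fin d → ℝ) (r : ℝ) (v : Fin d → ℝ) : Fin d → ℝ := r⁻¹ • (v - z)

theorem measurable_rescale (z : Fin d → ℝ) (r : ℝ) : Measurable (rescale z r) := by
  unfold rescale
  fun_prop

theorem volume_real_preimage_rescale (z : Fin d → ℝ) {r : ℝ} (hr : 0 < r) (A : Set (Fin d → ℝ)) :
    volume.real (rescale z r ⁻¹' A) = r ^ d * volume.real A := by
  have h : rescale z r ⁻¹' A = (fun v => v - z) ⁻¹' ((r⁻¹ • ·) ⁻¹' A) := rfl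
  have h2 : (fun v => v - z) ⁻¹' ((r⁻¹ • ·) ⁻¹' A) = (fun v => v + -z) ⁻¹' ((r⁻¹ • ·) ⁻¹' A) := by
    simp [sub_eq_add_neg]
  rw [h, h2, Measure.real, measure_preimage_add_right,
    Measure.addHaar_preimage_smul _ (inv_ne_zero hr.ne'), ENNReal.toReal_mul,
    ENNReal.toReal_ofReal (abs_nonneg _), Module.finrank_fin_fun, inv_pow, inv_inv,
    abs_of_pos (pow_pos hr d)]
  rfl

theorem dist_le_of_rescale_mem {z v : Fin d → ℝ} {r : ℝ} (hr : 0 < r)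
    (h : rescale z r v ∈ unitCube d) : dist z v ≤ r := by
  refine (dist_pi_le_iff hr.le).2 fun l => ?_
  have h1 := h l trivial
  simp only [rescale, Pi.smul_apply, Pi.sub_apply, smul_eq_mul] at h1
  have h2 : r⁻¹ * (v l - z l) * r = v l - z l := by field_simp
  have h3 := mul_le_mul_of_nonneg_right h1.2.le hr.le
  have h4 := mul_le_mul_of_nonneg_right h1.1 hr.le
  rw [h2] at h3 h4
  rw [Real.dist_eq, abs_le]
  constructor <;> linarith

/-- Compactness of `H` gives one radius for all centres, the source of the uniformity over the
triangular array. -/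
theorem IsCompact.exists_forall_dist_le_abs_sub_le {H O : Set (Fin d → ℝ)} (hH : IsCompact H)
    (hO : IsOpen O) (hHO : H ⊆ O) {f : (Fin d → ℝ) → ℝ} (hf : ContinuousOn f O) {τ : ℝ}
    (hτ : 0 < τ) :
    ∃ r₀ > 0, ∀ z ∈ H, ∀ v, dist z v ≤ r₀ → v ∈ O ∧ |f v - f z| ≤ τ := by
  obtain ⟨δ, hδ, hδO⟩ := hH.exists_cthickening_subset_open hO hHO
  have h := hH.uniformContinuousAt_of_continuousAt f
    (fun a ha => hf.continuousAt (hO.mem_nhds (hHO ha))) (Metric.dist_mem_uniformity hτ)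
  obtain ⟨δ', hδ', h'⟩ := Metric.mem_uniformity_dist.1 h
  refine ⟨min δ (δ' / 2), lt_min hδ (half_pos hδ'), fun z hz v hv => ⟨hδO ?_, ?_⟩⟩
  · refine Metric.mem_cthickening_of_dist_le v z δ H hz ?_
    rw [dist_comm]
    exact hv.trans (min_le_left _ _)
  · have : dist z v < δ' := (hv.trans (min_le_right _ _)).trans_lt (half_lt_self hδ')
    have := h' this hz
    rw [Set.mem_ofPred_eq, dist_comm, Real.dist_eq] at this
    exact this.le

/-- The probability of a small cell around `z` is asymptotically proportional to `f z`, uniformly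
in `z`. -/
theorem abs_measureReal_preimage_rescale_sub_le {ν : Measure (Fin d → ℝ)} [IsFiniteMeasure ν]
    {O : Set (Fin d → ℝ)} {f : (Fin d → ℝ) → ℝ}
    (hdens : ν.restrict O = (volume.restrict O).withDensity fun x => ENNReal.ofReal (f x))
    {z : Fin d → ℝ} {r τ : ℝ} (hr : 0 < r) (hfpos : 0 ≤ f z)
    (hloc : ∀ v, dist z v ≤ r → v ∈ O ∧ |f v - f z| ≤ τ) {A : Set (Fin d → ℝ)}
    (hA : MeasurableSet A) (hAc : A ⊆ unitCube d) :
    |ν.real (rescale z r ⁻¹' A) - f z * (r ^ d * volume.real A)| ≤ τ * r ^ d := by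
  set B := rescale z r ⁻¹' A with hB
  have hBm : MeasurableSet B := measurable_rescale z r hA
  have hBloc : ∀ v ∈ B, v ∈ O ∧ |f v - f z| ≤ τ := fun v hv =>
    hloc v (dist_le_of_rescale_mem hr (hAc hv))
  have hBO : B ⊆ O := fun v hv => (hBloc v hv).1
  have hτ : 0 ≤ τ := (abs_nonneg _).trans (hloc z (by simpa using hr.le)).2
  have hvol := volume_real_preimage_rescale z hr A
  rw [← hB] at hvol
  have hBfin : volume B ≠ ⊤ := by
    refine ne_top_of_le_ne_top (measure_closedBall_lt_top (x := z) (r := r)).ne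
      (measure_mono fun v hv => ?_)
    rw [Metric.mem_closedBall, dist_comm]
    exact dist_le_of_rescale_mem hr (hAc hv)
  have hA1 : volume.real A ≤ 1 := by
    rw [← volume_real_unitCube d]
    exact measureReal_mono hAc (by simp [volume_unitCube])
  have hν : ν B = ∫⁻ v in B, ENNReal.ofReal (f v) := by
    have h := congrArg (fun κ : Measure (Fin d → ℝ) => κ B) hdens
    rwa [Measure.restrict_apply hBm, withDensity_apply _ hBm, Measure.restrict_restrict hBm,
      Set.inter_eq_left.2 hBO] at h
  have hτr : τ * volume.real B ≤ τ * r ^ d := by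
    rw [hvol]
    refine mul_le_mul_of_nonneg_left ?_ hτ
    exact mul_le_of_le_one_right (by positivity) hA1
  have hup : ν.real B ≤ (f z + τ) * volume.real B := by
    refine ENNReal.toReal_le_of_le_ofReal (by positivity) ?_
    rw [hν, ENNReal.ofReal_mul (by positivity), ofReal_measureReal hBfin]
    refine (setLIntegral_mono' hBm fun v hv => ENNReal.ofReal_le_ofReal
      (show f v ≤ f z + τ by linarith [(abs_le.1 (hBloc v hv).2).2])).trans_eq ?_
    rw [setLIntegral_const]
  have hlow : (f z - τ) * volume.real B ≤ ν.real B := by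
    -- A nonpositive lower density bound is trivial, and `ENNReal.ofReal` would truncate it.
    rcases le_or_gt (f z - τ) 0 with h | h
    · exact (mul_nonpos_of_nonpos_of_nonneg h measureReal_nonneg).trans measureReal_nonneg
    · refine (ENNReal.ofReal_le_iff_le_toReal (measure_ne_top ν B)).1 ?_
      rw [hν, ENNReal.ofReal_mul h.le, ofReal_measureReal hBfin, ← setLIntegral_const]
      exact setLIntegral_mono' hBm fun v hv => ENNReal.ofReal_le_ofReal
        (by linarith [(abs_le.1 (hBloc v hv).2).1])
  rw [← hvol, abs_le]
  constructor <;> linarith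

/-- Ensures that almost surely no sample point sits at the centre, so that the paths vanish at the
origin. -/
theorem measure_singleton_eq_zero_of_density (hd : 1 ≤ d) {ν : Measure (Fin d → ℝ)}
    {O : Set (Fin d → ℝ)} {g : (Fin d → ℝ) → ℝ≥0∞}
    (hdens : ν.restrict O = (volume.restrict O).withDensity g) {z : Fin d → ℝ} (hz : z ∈ O) :
    ν {z} = 0 := by
  have : Nonempty (Fin d) := ⟨⟨0, hd⟩⟩
  have h := congrArg (fun κ : Measure (Fin d → ℝ) => κ {z}) hdens
  rw [Measure.restrict_apply (measurableSet_singleton z),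
    Set.inter_eq_left.2 (Set.singleton_subset_iff.2 hz)] at h
  rw [h]
  exact withDensity_absolutelyContinuous _ _
    (le_antisymm ((Measure.restrict_apply_le _ _).trans_eq (measure_singleton z)) zero_le)

/-- The asymptotics of the speeds and of the means of the cell counts, uniformly over the rows of
the triangular array. -/
theorem tendsto_speed_and_mean (hd : 1 ≤ d) {ν : Measure (Fin d → ℝ)} [IsFiniteMeasure ν]
    {O : Set (Fin d → ℝ)} (hO : IsOpen O) {f : (Fin d → ℝ) → ℝ}
    (hdens : ν.restrict O = (volume.restrict O).withDensity fun x => ENNReal.ofReal (f x))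
    (hfcont : ContinuousOn f O) (hfpos : ∀ x ∈ O, 0 < f x)
    {H : Set (Fin d → ℝ)} (hH : IsCompact H) (hHO : H ⊆ O)
    {c : ℝ} (hc : 0 < c) {h : ℕ → ℝ} (hh0 : ∀ n, 1 ≤ n → 0 < h n) (hhlim : Tendsto h atTop (𝓝 0))
    (hc_lim : Tendsto (fun n : ℕ => (n : ℝ) * h n / Real.log n) atTop (𝓝 c))
    {m : ℕ → ℕ} {z : (n : ℕ) → Fin (m n) → Fin d → ℝ} (hz : ∀ n i, z n i ∈ H) :
    Tendsto (fun p : Σ n, Fin (m n) => 1 / (c * f (z p.1 p.2) * Real.log p.1))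
      (comap Sigma.fst atTop) (𝓝[>] 0) ∧
    ∀ A : Set (Fin d → ℝ), MeasurableSet A → A ⊆ unitCube d →
      Tendsto (fun p : Σ n, Fin (m n) => 1 / (c * f (z p.1 p.2) * Real.log p.1) *
        (p.1 * ν.real (rescale (z p.1 p.2) (h p.1 ^ (1 / (d : ℝ))) ⁻¹' A)))
        (comap Sigma.fst atTop) (𝓝 (volume.real A)) := by
  -- The minimum of `f` over `H`; it makes the speeds vanish uniformly.
  obtain ⟨a, ha, hfa⟩ : ∃ a > 0, ∀ x ∈ H, a ≤ f x := by
    rcases H.eq_empty_or_nonempty with rfl | hne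
    · exact ⟨1, one_pos, by simp⟩
    · obtain ⟨x, hx, hmin⟩ := hH.exists_isMinOn hne (hfcont.mono hHO)
      exact ⟨f x, hfpos x (hHO hx), fun y hy => hmin hy⟩
  have hfst : Tendsto (Sigma.fst : (Σ n, Fin (m n)) → ℕ) (comap Sigma.fst atTop) atTop :=
    tendsto_comap
  have hlog : Tendsto (fun n : ℕ => Real.log n) atTop atTop :=
    Real.tendsto_log_atTop.comp tendsto_natCast_atTop_atTop
  refine ⟨tendsto_nhdsWithin_iff.2 ⟨?_, ?_⟩, fun A hA hAc => ?_⟩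
  · have hlim : Tendsto (fun n : ℕ => 1 / (c * a * Real.log n)) atTop (𝓝 0) := by
      simp only [one_div]
      exact (hlog.const_mul_atTop (mul_pos hc ha)).inv_tendsto_atTop
    refine squeeze_zero' ?_ ?_ (hlim.comp hfst)
    · filter_upwards [hfst.eventually (hlog.eventually_gt_atTop 0)] with p hp
      have := hfpos _ (hHO (hz p.1 p.2))
      positivity
    · filter_upwards [hfst.eventually (hlog.eventually_gt_atTop 0)] with p hp
      have := hfa _ (hz p.1 p.2)
      simp only [Function.comp_apply]
      gcongr
  · filter_upwards [hfst.eventually (hlog.eventually_gt_atTop 0)] with p hp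
    have := hfpos _ (hHO (hz p.1 p.2))
    exact Set.mem_Ioi.2 (by positivity)
  · have hr : Tendsto (fun n => h n ^ (1 / (d : ℝ))) atTop (𝓝 0) := by
      have hd' : (0 : ℝ) < 1 / d := by
        have : (0 : ℝ) < d := by exact_mod_cast hd
        positivity
      have := hhlim.rpow_const (p := 1 / (d : ℝ)) (Or.inr hd'.le)
      rwa [Real.zero_rpow hd'.ne'] at this
    have hw : Tendsto (fun n : ℕ => (n : ℝ) * h n / Real.log n / c * volume.real A) atTop
        (𝓝 (volume.real A)) := by
      have := (hc_lim.div_const c).mul_const (volume.real A)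
      rwa [div_self hc.ne', one_mul] at this
    rw [Metric.tendsto_nhds]
    intro δ hδ
    -- The oscillation of `f` then costs at most `2 * c * (τ / (c * a)) = δ / 2`.
    set τ := δ * a / 4 with hτ
    have hτ0 : 0 < τ := by positivity
    obtain ⟨r₀, hr₀, hloc⟩ := hH.exists_forall_dist_le_abs_sub_le hO hHO hfcont hτ0
    have hc2 := hc_lim.eventually_lt_const (show c < 2 * c by linarith)
    filter_upwards [hfst.eventually (hlog.eventually_gt_atTop 0),
      hfst.eventually (hr.eventually_le_const hr₀), hfst.eventually (eventually_ge_atTop 1),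
      hfst.eventually hc2, hfst.eventually (Metric.tendsto_nhds.1 hw (δ / 2) (half_pos hδ))]
      with p hp1 hp2 hp3 hp4 hp5
    have hhp := hh0 _ hp3
    have hzH := hz p.1 p.2
    have hf0 := hfpos _ (hHO hzH)
    have hfz := hfa _ hzH
    have hrpos : 0 < h p.1 ^ (1 / (d : ℝ)) := Real.rpow_pos_of_pos hhp _
    have hrd : (h p.1 ^ (1 / (d : ℝ))) ^ d = h p.1 := by
      rw [one_div]
      exact Real.rpow_inv_natCast_pow hhp.le (by omega)
    have key := abs_measureReal_preimage_rescale_sub_le hdens hrpos hf0.le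
      (fun v hv => hloc _ hzH v (hv.trans hp2)) hA hAc
    rw [hrd] at key
    set w := ν.real (rescale (z p.1 p.2) (h p.1 ^ (1 / (d : ℝ))) ⁻¹' A)
    set L := Real.log p.1
    set F := f (z p.1 p.2)
    set V := volume.real A
    have hn : (0 : ℝ) < p.1 := by exact_mod_cast hp3
    have e1 : 1 / (c * F * L) * (p.1 * w) - p.1 * h p.1 / L / c * V =
        p.1 / (c * F * L) * (w - F * (h p.1 * V)) := by
      field_simp
    have e2 : |1 / (c * F * L) * (p.1 * w) - p.1 * h p.1 / L / c * V| ≤ δ / 2 := by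
      rw [e1, abs_mul, abs_of_pos (by positivity)]
      calc p.1 / (c * F * L) * |w - F * (h p.1 * V)|
          ≤ p.1 / (c * F * L) * (τ * h p.1) := by gcongr
        _ = p.1 * h p.1 / L * (τ / (c * F)) := by field_simp
        _ ≤ 2 * c * (τ / (c * a)) := by gcongr
        _ = δ / 2 := by rw [hτ]; field_simp; norm_num
    calc dist (1 / (c * F * L) * (p.1 * w)) V
        ≤ dist (1 / (c * F * L) * (p.1 * w)) (p.1 * h p.1 / L / c * V) +
          dist (p.1 * h p.1 / L / c * V) V := dist_triangle _ _ _
      _ < δ / 2 + δ / 2 := add_lt_add_of_le_of_lt (by rwa [Real.dist_eq]) hp5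
      _ = δ := add_halves δ

end LocalIntensity

/-! ### Reduction of open and closed sets to cell masses. -/

section Deterministic

variable {d : ℕ}

theorem exists_BCone_eq_measureReal (ν : Measure (Fin d → ℝ)) [IsFiniteMeasure ν] (h0 : ν {0} = 0) :
    ∃ g : BCone d, ∀ s : unitCube d, g.1 s = ν.real (Set.Icc 0 (s : Fin d → ℝ)) := by
  have hmem : Memℓp (fun s : unitCube d => ν.real (Set.Icc 0 (s : Fin d → ℝ))) ∞ := by
    refine memℓp_infty ⟨ν.real Set.univ, ?_⟩
    rintro _ ⟨s, rfl⟩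
    exact (Real.norm_of_nonneg measureReal_nonneg).trans_le (measureReal_mono (Set.subset_univ _))
  refine ⟨⟨⟨_, hmem⟩, fun s t hst => ?_, ?_⟩, fun s => rfl⟩
  · exact measureReal_mono (Set.Icc_subset_Icc_right hst)
  · change ν.real (Set.Icc 0 0) = 0
    rw [Set.Icc_self, Measure.real, h0, ENNReal.toReal_zero]

/-- Legendre duality: the optimal `l` is `log (x / q)`, or the limit `l → -∞` when `x = 0`. Combined
with the integrated Young inequality on a cell, it plays the role of Jensen's inequality. -/
theorem mul_klFun_div_le_of_forall {q x e : ℝ} (hq : 0 < q) (hx : 0 ≤ x)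
    (h : ∀ l, l * x ≤ e + q * (Real.exp l - 1)) : q * klFun (x / q) ≤ e := by
  rcases hx.eq_or_lt with rfl | hx
  · rw [zero_div, klFun_zero, mul_one]
    have hlim : Tendsto (fun l => e + q * (Real.exp l - 1)) atBot (𝓝 (e + q * (0 - 1))) :=
      ((Real.tendsto_exp_atBot.sub_const 1).const_mul q).const_add e
    have := ge_of_tendsto' hlim fun l => (mul_zero l).symm.trans_le (h l)
    linarith
  · have h1 := h (Real.log (x / q))
    rw [Real.exp_log (div_pos hx hq), Real.log_div hx.ne' hq.ne'] at h1
    rw [mul_klFun_div hq hx]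
    have h2 : q * (x / q - 1) = x - q := by field_simp
    linarith

/-- The density that is constant on the cells of the grid and gives mass `y j` to the cell `j`. -/
noncomputable def stepDensity (K : ℕ) (y : (Fin d → Fin K) → ℝ) (u : Fin d → ℝ) : ℝ :=
  ∑ j, (gridCell K j).indicator (fun _ => y j / ((K : ℝ) ^ d)⁻¹) u

theorem stepDensity_of_mem {K : ℕ} (y : (Fin d → Fin K) → ℝ) {j : Fin d → Fin K} {u : Fin d → ℝ}
    (hu : u ∈ gridCell K j) : stepDensity K y u = y j / ((K : ℝ) ^ d)⁻¹ := by
  rw [stepDensity, Finset.sum_eq_single j]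
  · rw [Set.indicator_of_mem hu]
  · intro i _ hij
    exact Set.indicator_of_notMem (fun hi => Set.disjoint_left.1
      (pairwise_disjoint_gridCell hij) hi hu) _
  · simp

theorem integrableOn_stepDensity (K : ℕ) (y : (Fin d → Fin K) → ℝ) :
    IntegrableOn (stepDensity K y) (unitCube d) :=
  integrable_finsetSum _ fun j _ => (integrable_const _).indicator (measurableSet_gridCell j)

theorem stepDensity_nonneg {K : ℕ} {y : (Fin d → Fin K) → ℝ} (hy : ∀ j, 0 ≤ y j) (u : Fin d → ℝ) :
    0 ≤ stepDensity K y u :=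
  Finset.sum_nonneg fun j _ => Set.indicator_nonneg (fun _ _ => div_nonneg (hy j) (by positivity)) _

theorem setIntegral_stepDensity {K : ℕ} (hK : 0 < K) (y : (Fin d → Fin K) → ℝ)
    (j : Fin d → Fin K) : ∫ u in gridCell K j, stepDensity K y u = y j := by
  rw [setIntegral_congr_fun (measurableSet_gridCell j) fun u hu => stepDensity_of_mem y hu,
    setIntegral_const, volume_real_gridCell hK, smul_eq_mul]
  have : (0 : ℝ) < K := by exact_mod_cast hK
  field_simp

theorem lintegral_chernoff_stepDensity {K : ℕ} (hK : 0 < K) {y : (Fin d → Fin K) → ℝ}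
    (hy : ∀ j, 0 ≤ y j) : ∫⁻ u in unitCube d, chernoff (stepDensity K y u) =
      ENNReal.ofReal (∑ j, ((K : ℝ) ^ d)⁻¹ * klFun (y j / ((K : ℝ) ^ d)⁻¹)) := by
  have hnn : ∀ j, 0 ≤ y j / ((K : ℝ) ^ d)⁻¹ := fun j => div_nonneg (hy j) (by positivity)
  rw [← sum_lintegral_gridCell hK, ENNReal.ofReal_sum_of_nonneg
    fun j _ => mul_nonneg (by positivity) (klFun_nonneg (hnn j))]
  refine Finset.sum_congr rfl fun j _ => ?_
  rw [setLIntegral_congr_fun (measurableSet_gridCell j)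
    fun u hu => by rw [stepDensity_of_mem y hu, chernoff_of_nonneg (hnn j)],
    setLIntegral_const, volume_gridCell hK, mul_comm, ENNReal.ofReal_mul (by positivity)]

theorem densityMeasure_singleton (hd : 1 ≤ d) (φ : (Fin d → ℝ) → ℝ) (u : Fin d → ℝ) :
    densityMeasure φ {u} = 0 := by
  have : Nonempty (Fin d) := ⟨⟨0, hd⟩⟩
  exact withDensity_absolutelyContinuous _ _
    (le_antisymm ((Measure.restrict_apply_le _ _).trans_eq (measure_singleton u)) zero_le)

/-- On a fine grid, the discrete entropy of a distribution function in a closed set almost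
dominates the infimum of the rate function over the set. -/
theorem exists_grid_lt_sum_klFun (hd : 1 ≤ d) {F : Set (BCone d)} (hF : IsClosed F) {a : ℝ≥0}
    (ha : (a : ℝ≥0∞) < ⨅ g ∈ F, rateI g) :
    ∃ K : ℕ, 0 < K ∧ ∀ (ν : Measure (Fin d → ℝ)) [IsFiniteMeasure ν], ∀ g ∈ F,
      (∀ s : unitCube d, g.1 s = ν.real (Set.Icc 0 (s : Fin d → ℝ))) →
      a < ∑ j : Fin d → Fin K,
        ((K : ℝ) ^ d)⁻¹ * klFun (ν.real (gridCell K j) / ((K : ℝ) ^ d)⁻¹) := by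
  have hdisj : Disjoint {g : BCone d | rateI g ≤ a} F :=
    Set.disjoint_left.2 fun g hg hgF => (ha.trans_le (iInf₂_le g hgF)).not_ge hg
  -- A compact set and a disjoint closed set have disjoint thickenings.
  obtain ⟨δ, hδ, hth⟩ := hdisj.exists_cthickenings (isRateFunction_rateI d a) hF
  obtain ⟨K, hK, hslab⟩ := exists_grid_slab_sum_le d a.2 (show 0 < δ / d by positivity)
  refine ⟨K, hK, fun ν _ g hg hgν => ?_⟩
  -- Otherwise the step density with the same cell masses has a distribution function `g'` in the
  -- sublevel set and within `δ` of `g`, against the separation.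
  by_contra! hle
  set y : (Fin d → Fin K) → ℝ := fun j => ν.real (gridCell K j) with hy
  have hq : (0 : ℝ) < ((K : ℝ) ^ d)⁻¹ := by
    have : (0 : ℝ) < K := by exact_mod_cast hK
    positivity
  have hy0 : ∀ j, 0 ≤ y j := fun j => measureReal_nonneg
  have hint := integrableOn_stepDensity K y
  have hnn := ae_of_all (volume.restrict (unitCube d)) (stepDensity_nonneg hy0)
  have hfin := isFiniteMeasure_densityMeasure hint
  obtain ⟨g', hg'⟩ := exists_BCone_eq_measureReal (densityMeasure (stepDensity K y))
    (densityMeasure_singleton hd _ _)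
  have hcell : ∀ j, (densityMeasure (stepDensity K y)).real (gridCell K j) = y j := fun j => by
    rw [densityMeasure_real hint hnn (measurableSet_gridCell j) (gridCell_subset_unitCube j),
      setIntegral_stepDensity hK]
  have hder : IsLebesgueDerivative g' (stepDensity K y) := ⟨hint, fun s => by
    rw [hg', densityMeasure_real hint hnn measurableSet_Icc (Icc_zero_subset_unitCube s.2)]⟩
  have hI : rateI g' ≤ a := by
    refine (iInf₂_le _ hder).trans ?_
    rw [lintegral_chernoff_stepDensity hK hy0]
    exact (ENNReal.ofReal_le_ofReal hle).trans_eq ENNReal.ofReal_coe_nnreal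
  have hsl : ∀ l i, ∑ j with j l = i,
      (densityMeasure (stepDensity K y)).real (gridCell K j) ≤ δ / d := by
    simp only [hcell]
    refine hslab y (fun j => ((K : ℝ) ^ d)⁻¹ * klFun (y j / ((K : ℝ) ^ d)⁻¹))
      (fun j => mul_nonneg hq.le (klFun_nonneg (div_nonneg (hy0 j) hq.le))) (fun l j => ?_) hle
    have := mul_le_mul_of_nonneg_left (mul_le_klFun_add_exp (div_nonneg (hy0 j) hq.le) l) hq.le
    have h2 : ((K : ℝ) ^ d)⁻¹ * (l * (y j / ((K : ℝ) ^ d)⁻¹)) = l * y j := by field_simp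
    rw [h2, mul_add] at this
    exact this
  have hdist : dist g g' ≤ δ := by
    refine BCone.dist_le hδ.le fun s => ?_
    rw [hgν, hg']
    -- The cell masses agree exactly, so only the slabs contribute, with total `d * (δ / d) = δ`.
    refine (abs_measureReal_Icc_sub_le hK ν _ (t := 0) (fun j => ?_) hsl s.2).trans_eq ?_
    · rw [hcell, sub_self, abs_zero]
    · have : (d : ℝ) ≠ 0 := by
        have : d ≠ 0 := by omega
        exact_mod_cast this
      field_simp
      ring
  exact Set.disjoint_left.1 hth (Metric.mem_cthickening_of_dist_le g g' δ _ hI hdist)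
    (Metric.self_subset_cthickening F hg)

/-- A distribution function with suitable masses on the cells of a fine grid belongs to a given
neighbourhood of an absolutely continuous function. -/
theorem exists_grid_forall_mem {G : Set (BCone d)} (hG : IsOpen G) {g : BCone d}
    (hg : g ∈ G) {φ : (Fin d → ℝ) → ℝ} (hφ : IsLebesgueDerivative g φ)
    (hfin : ∫⁻ u in unitCube d, chernoff (φ u) ≠ ⊤) :
    ∃ K : ℕ, 0 < K ∧ ∃ t > 0, ∃ x : (Fin d → Fin K) → ℝ, (∀ j, 0 ≤ x j) ∧
      ∑ j, ((K : ℝ) ^ d)⁻¹ * klFun (x j / ((K : ℝ) ^ d)⁻¹) ≤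
        (∫⁻ u in unitCube d, chernoff (φ u)).toReal ∧
      ∀ (ν : Measure (Fin d → ℝ)) [IsFiniteMeasure ν], ν {0} = 0 →
        (∀ j, |ν.real (gridCell K j) - x j| ≤ t) →
        ∃ g' ∈ G, ∀ s : unitCube d, g'.1 s = ν.real (Set.Icc 0 (s : Fin d → ℝ)) := by
  obtain ⟨δ, hδ, hball⟩ := Metric.isOpen_iff.1 hG g hg
  have hφ0 := ae_nonneg_of_lintegral_chernoff_ne_top hφ.1.aemeasurable hfin
  have hfm := isFiniteMeasure_densityMeasure hφ.1
  set b : ℝ := δ / (4 * (d + 1)) with hb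
  have hb0 : 0 < b := by positivity
  obtain ⟨K, hK, hslab⟩ := exists_grid_slab_sum_le d
    (ENNReal.toReal_nonneg (a := ∫⁻ u in unitCube d, chernoff (φ u))) hb0
  have hK' : (0 : ℝ) < K := by exact_mod_cast hK
  have hq : (0 : ℝ) < ((K : ℝ) ^ d)⁻¹ := by positivity
  have hcell : ∀ j, (densityMeasure φ).real (gridCell K j) = ∫ u in gridCell K j, φ u := fun j =>
    densityMeasure_real hφ.1 hφ0 (measurableSet_gridCell j) (gridCell_subset_unitCube j)
  have hx0 : ∀ j : Fin d → Fin K, 0 ≤ ∫ u in gridCell K j, φ u := fun j => by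
    rw [← hcell]
    exact measureReal_nonneg
  have hyoung := fun l (j : Fin d → Fin K) => mul_setIntegral_gridCell_le hK j hφ.1 hfin l
  have hsum := (sum_toReal_lintegral_gridCell hK hfin).le
  refine ⟨K, hK, δ / (4 * K ^ d), by positivity, fun j => ∫ u in gridCell K j, φ u, hx0, ?_, ?_⟩
  · exact (Finset.sum_le_sum fun j _ =>
      mul_klFun_div_le_of_forall hq (hx0 j) fun l => hyoung l j).trans hsum
  · intro ν _ hν0 hν
    obtain ⟨g', hg'⟩ := exists_BCone_eq_measureReal ν hν0
    refine ⟨g', hball ?_, hg'⟩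
    have hsl : ∀ l i, ∑ j with j l = i, (densityMeasure φ).real (gridCell K j) ≤ b := by
      simp only [hcell]
      exact hslab _ _ (fun j => ENNReal.toReal_nonneg) hyoung hsum
    have hle : (K : ℝ) ^ d * (δ / (4 * K ^ d)) + d * b ≤ δ / 2 := by
      have h1 : (K : ℝ) ^ d * (δ / (4 * K ^ d)) = δ / 4 := by field_simp
      have h2 : d * b ≤ δ / 4 := by
        rw [hb, mul_div_assoc', div_le_div_iff₀ (by positivity) (by positivity)]
        nlinarith
      linarith
    refine Metric.mem_ball.2 ((BCone.dist_le (half_pos hδ).le fun s => ?_).trans_lt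
      (half_lt_self hδ))
    rw [hg', hφ.apply_eq hφ0]
    refine (abs_measureReal_Icc_sub_le hK _ _ (fun j => ?_) hsl s.2).trans hle
    rw [hcell]
    exact hν j

end Deterministic

/-! ### Joint probabilities and product moments of cell counts. -/

section Counts

variable {Ω E ι : Type*} [MeasurableSpace Ω] [MeasurableSpace E] {P : Measure Ω}
  [IsProbabilityMeasure P] {Z : ℕ → Ω → E} {N : Ω → ℕ} {r : ℝ≥0} [Fintype ι] {C : ι → Set E}

theorem measure_forall_sampleCount_eq (hZ : ∀ j, Measurable (Z j)) (hZindep : iIndepFun Z P)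
    (hZident : ∀ j, IdentDistrib (Z j) (Z 0) P P) (hN : Measurable N)
    (hNlaw : P.map N = poissonMeasure r) (hindep : IndepFun N (fun ω j => Z j ω) P)
    (hC : ∀ i, MeasurableSet (C i)) (hdisj : Pairwise (Function.onFun Disjoint C)) (k : ι → ℕ) :
    P {ω | ∀ i, sampleCount Z N (C i) ω = k i} =
      ∏ i, poissonMeasure (r * (P.map (Z 0) (C i)).toNNReal) {k i} := by
  have h := (iIndepFun_sampleCount hZ hZindep hZident hN hNlaw hindep hC
    hdisj).measure_inter_preimage_eq_mul Finset.univ (sets := fun i => {k i})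
    (fun i _ => measurableSet_singleton _)
  have hset : {ω | ∀ i, sampleCount Z N (C i) ω = k i} =
      ⋂ i ∈ Finset.univ, sampleCount Z N (C i) ⁻¹' {k i} := by
    ext ω
    simp
  rw [hset, h]
  refine Finset.prod_congr rfl fun i _ => ?_
  rw [← map_sampleCount hZ hZindep hZident hN hNlaw hindep (hC i),
    Measure.map_apply (measurable_sampleCount hZ hN (hC i)) (measurableSet_singleton _)]

theorem lintegral_prod_sampleCount (hZ : ∀ j, Measurable (Z j)) (hZindep : iIndepFun Z P)
    (hZident : ∀ j, IdentDistrib (Z j) (Z 0) P P) (hN : Measurable N)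
    (hNlaw : P.map N = poissonMeasure r) (hindep : IndepFun N (fun ω j => Z j ω) P)
    (hC : ∀ i, MeasurableSet (C i)) (hdisj : Pairwise (Function.onFun Disjoint C))
    (u : ℕ → ℝ≥0∞) :
    ∫⁻ ω, ∏ i, u (sampleCount Z N (C i) ω) ∂P =
      ∏ i, ∫⁻ k, u k ∂poissonMeasure (r * (P.map (Z 0) (C i)).toNNReal) := by
  have hu : Measurable u := Measurable.of_discrete
  have hm := fun i => measurable_sampleCount hZ hN (hC i)
  rw [lintegral_prod_eq_prod_lintegral_of_indepFun Finset.univ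
    (fun i ω => u (sampleCount Z N (C i) ω))
    ((iIndepFun_sampleCount hZ hZindep hZident hN hNlaw hindep hC hdisj).comp
      (fun _ => u) fun _ => hu) fun i => hu.comp (hm i)]
  refine Finset.prod_congr rfl fun i _ => ?_
  rw [← map_sampleCount hZ hZindep hZident hN hNlaw hindep (hC i), lintegral_map hu (hm i)]

end Counts

/-! ### Large deviation bounds for Poisson arrays along a filter. -/

section PoissonArray

variable {Ω E β : Type*} {d : ℕ}

/-- The image under `T` of the sample `Z 0, …, Z (N - 1)`, each point having mass `ε`. -/
noncomputable def empiricalMeasure (Z : ℕ → Ω → E) (N : Ω → ℕ) (T : E → Fin d → ℝ) (ε : ℝ)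
    (ω : Ω) : Measure (Fin d → ℝ) :=
  ε.toNNReal • ∑ k ∈ Finset.range (N ω), Measure.dirac (T (Z k ω))

instance isFiniteMeasure_empiricalMeasure (Z : ℕ → Ω → E) (N : Ω → ℕ) (T : E → Fin d → ℝ) (ε : ℝ)
    (ω : Ω) : IsFiniteMeasure (empiricalMeasure Z N T ε ω) := by
  unfold empiricalMeasure
  infer_instance

theorem empiricalMeasure_real_apply {Z : ℕ → Ω → E} {N : Ω → ℕ} {T : E → Fin d → ℝ} {ε : ℝ}
    (hε : 0 ≤ ε) (ω : Ω) {A : Set (Fin d → ℝ)} (hA : MeasurableSet A) :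
    (empiricalMeasure Z N T ε ω).real A =
      ε * ∑ k ∈ Finset.range (N ω), A.indicator (fun _ => (1 : ℝ)) (T (Z k ω)) := by
  rw [empiricalMeasure, measureReal_nnreal_smul_apply, Real.coe_toNNReal _ hε, Measure.real,
    Measure.finsetSum_apply, ENNReal.toReal_sum fun k _ => measure_ne_top _ _]
  congr 2 with k
  rw [Measure.dirac_apply' _ hA]
  by_cases h : T (Z k ω) ∈ A <;> simp [h]

theorem empiricalMeasure_real_eq_sampleCount {Z : ℕ → Ω → E} {N : Ω → ℕ} {T : E → Fin d → ℝ}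
    {ε : ℝ} (hε : 0 ≤ ε) (ω : Ω) {A : Set (Fin d → ℝ)} (hA : MeasurableSet A) :
    (empiricalMeasure Z N T ε ω).real A = ε * sampleCount Z N (T ⁻¹' A) ω := by
  rw [empiricalMeasure_real_apply hε ω hA, sampleCount]
  push_cast
  congr 2 with k
  by_cases h : T (Z k ω) ∈ A <;> simp [h]

theorem empiricalMeasure_singleton_eq_zero {Z : ℕ → Ω → E} {N : Ω → ℕ} {T : E → Fin d → ℝ}
    {ε : ℝ} {ω : Ω} {u : Fin d → ℝ} (h : ∀ k, T (Z k ω) ≠ u) :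
    empiricalMeasure Z N T ε ω {u} = 0 := by
  rw [empiricalMeasure, Measure.smul_apply, Measure.finsetSum_apply, Finset.sum_eq_zero, smul_zero]
  intro k _
  rw [Measure.dirac_apply' _ (measurableSet_singleton u)]
  simp [h k]

theorem pairwise_disjoint_preimage_gridCell (f : E → Fin d → ℝ) (K : ℕ) :
    Pairwise (Function.onFun Disjoint fun j : Fin d → Fin K => f ⁻¹' gridCell K j) :=
  fun _ _ hij => (pairwise_disjoint_gridCell hij).preimage f

variable [MeasurableSpace Ω] [MeasurableSpace E] {P : Measure Ω}

/-- A family of Poissonized i.i.d. samples, indexed by `b : β`, whose intensity in the local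
coordinate `T b` is asymptotically `1 / ε b` times Lebesgue measure on the cube. -/
structure IsPoissonArray (P : Measure Ω) (l : Filter β) (Z : ℕ → Ω → E) (N : β → Ω → ℕ)
    (rate : β → ℝ≥0) (T : β → E → Fin d → ℝ) (ε : β → ℝ) : Prop where
  measurable_sample : ∀ j, Measurable (Z j)
  iIndepFun_sample : iIndepFun Z P
  identDistrib_sample : ∀ j, IdentDistrib (Z j) (Z 0) P P
  measurable_size : ∀ b, Measurable (N b)
  law_size : ∀ b, P.map (N b) = poissonMeasure (rate b)
  indepFun : ∀ b, IndepFun (N b) (fun ω j => Z j ω) P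
  measurable_coord : ∀ b, Measurable (T b)
  speed : Tendsto ε l (𝓝[>] 0)
  mean : ∀ A : Set (Fin d → ℝ), MeasurableSet A → A ⊆ unitCube d →
    Tendsto (fun b => ε b * (rate b * (P.map (Z 0)).real (T b ⁻¹' A))) l (𝓝 (volume.real A))
  null : ∀ᶠ b in l, ∀ k, P {ω | T b (Z k ω) = 0} = 0

namespace IsPoissonArray

variable {l : Filter β} {Z : ℕ → Ω → E} {N : β → Ω → ℕ} {rate : β → ℝ≥0}
  {T : β → E → Fin d → ℝ} {ε : β → ℝ}

/-- The expected number of sample points in a cell of the grid. -/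
noncomputable def cellMean (P : Measure Ω) (Z : ℕ → Ω → E) (rate : β → ℝ≥0) (T : β → E → Fin d → ℝ)
    {K : ℕ} (j : Fin d → Fin K) (b : β) : ℝ≥0 :=
  rate b * (P.map (Z 0) (T b ⁻¹' gridCell K j)).toNNReal

theorem tendsto_cellMean (h : IsPoissonArray P l Z N rate T ε) {K : ℕ} (hK : 0 < K)
    (j : Fin d → Fin K) :
    Tendsto (fun b => ε b * cellMean P Z rate T j b) l (𝓝 ((K : ℝ) ^ d)⁻¹) := by
  have := h.mean _ (measurableSet_gridCell j) (gridCell_subset_unitCube j)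
  rw [volume_real_gridCell hK] at this
  exact this

theorem measurableSet_preimage_gridCell (h : IsPoissonArray P l Z N rate T ε) (b : β) {K : ℕ}
    (j : Fin d → Fin K) : MeasurableSet (T b ⁻¹' gridCell K j) :=
  h.measurable_coord b (measurableSet_gridCell j)

/-- Prescribing the count `⌊x j / ε b⌋₊` in every cell already forces the path into `G`, up to a
null event. Its probability is a product of Poisson weights, each estimated by the local lower
bound. -/
theorem lower_bound [IsProbabilityMeasure P] (h : IsPoissonArray P l Z N rate T ε)
    {G : Set (BCone d)} (hG : IsOpen G) {g : BCone d} (hg : g ∈ G) {φ : (Fin d → ℝ) → ℝ}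
    (hφ : IsLebesgueDerivative g φ) (hfin : ∫⁻ u in unitCube d, chernoff (φ u) ≠ ⊤) {a : ℝ}
    (ha : a < -(∫⁻ u in unitCube d, chernoff (φ u)).toReal) :
    ∀ᶠ b in l, (a : EReal) ≤ (ε b : EReal) * ENNReal.log (innerProb P (pathIn
      (fun ω (s : unitCube d) => (empiricalMeasure Z (N b) (T b) (ε b) ω).real
        (Set.Icc 0 (s : Fin d → ℝ))) G)) := by
  obtain ⟨K, hK, t, ht, x, hx, hxsum, hmem⟩ := exists_grid_forall_mem hG hg hφ hfin
  have hK' : (0 : ℝ) < K := by exact_mod_cast hK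
  set q : ℝ := ((K : ℝ) ^ d)⁻¹ with hq
  have hq0 : 0 < q := by positivity
  set S := ∑ j, q * klFun (x j / q) with hS
  -- The slack `-a - S` is shared equally among the `1 / q` cells.
  have hη : 0 < (-a - S) * q := mul_pos (by linarith) hq0
  have hcells : ∀ j, ∀ᶠ b in l, 0 < cellMean P Z rate T j b ∧
      -(q * klFun (x j / q)) - (-a - S) * q ≤
        ε b * Real.log ((poissonMeasure (cellMean P Z rate T j b)).real {⌊x j / ε b⌋₊}) := fun j =>
    eventually_le_mul_log_poissonMeasure h.speed (h.tendsto_cellMean hK j) hq0 (hx j) (by linarith)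
  have hε0 := h.speed.eventually eventually_mem_nhdsWithin
  have hεt := (tendsto_nhds_of_tendsto_nhdsWithin h.speed).eventually_le_const ht
  filter_upwards [eventually_all.2 hcells, hε0, hεt, h.null] with b hb hεb hεt hnull
  have hεb : 0 < ε b := hεb
  set C : (Fin d → Fin K) → Set E := fun j => T b ⁻¹' gridCell K j with hC
  set A : Set Ω := {ω | ∀ j, sampleCount Z (N b) (C j) ω = ⌊x j / ε b⌋₊} with hA
  -- Off this null event the empirical measure has no atom at the origin. The measurable set `A \ B`
  -- is the witness for the inner probability.
  set B : Set Ω := ⋃ k, {ω | T b (Z k ω) = 0} with hB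
  have hCm := h.measurableSet_preimage_gridCell b (K := K)
  have hAm : MeasurableSet A := by
    have : A = ⋂ j, sampleCount Z (N b) (C j) ⁻¹' {⌊x j / ε b⌋₊} := by
      ext ω
      simp [hA]
    rw [this]
    exact MeasurableSet.iInter fun j =>
      measurable_sampleCount h.measurable_sample (h.measurable_size b) (hCm j)
        (measurableSet_singleton _)
  have hBm : MeasurableSet B := MeasurableSet.iUnion fun k =>
    ((h.measurable_coord b).comp (h.measurable_sample k)) (measurableSet_singleton 0)
  have hsub : A \ B ⊆ pathIn (fun ω (s : unitCube d) =>
      (empiricalMeasure Z (N b) (T b) (ε b) ω).real (Set.Icc 0 (s : Fin d → ℝ))) G := by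
    rintro ω ⟨hωA, hωB⟩
    refine hmem _ (empiricalMeasure_singleton_eq_zero fun k hk =>
      hωB (Set.mem_iUnion.2 ⟨k, hk⟩)) fun j => ?_
    -- Rounding down changes the mass by at most `ε b ≤ t`.
    rw [empiricalMeasure_real_eq_sampleCount hεb.le ω (measurableSet_gridCell j), hωA j]
    have h0 : 0 ≤ x j / ε b := div_nonneg (hx j) hεb.le
    have h1 := Nat.floor_le h0
    have h2 := Nat.lt_floor_add_one (x j / ε b)
    rw [le_div_iff₀ hεb] at h1
    rw [div_lt_iff₀ hεb] at h2
    rw [abs_le]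
    constructor <;> nlinarith
  have hPA : P (A \ B) = ENNReal.ofReal
      (∏ j, (poissonMeasure (cellMean P Z rate T j b)).real {⌊x j / ε b⌋₊}) := by
    rw [measure_sdiff_null (measure_iUnion_null hnull), hA,
      measure_forall_sampleCount_eq h.measurable_sample h.iIndepFun_sample h.identDistrib_sample
        (h.measurable_size b) (h.law_size b) (h.indepFun b) hCm
        (pairwise_disjoint_preimage_gridCell _ _), ENNReal.ofReal_prod_of_nonneg
        fun j _ => measureReal_nonneg]
    exact Finset.prod_congr rfl fun j _ => (ofReal_measureReal).symm
  have hpos : ∀ j, 0 < (poissonMeasure (cellMean P Z rate T j b)).real {⌊x j / ε b⌋₊} := fun j =>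
    poissonMeasure_real_singleton_pos _ (hb j).1
  have hlog : (ε b : EReal) * ENNReal.log (P (A \ B)) ≤ (ε b : EReal) * ENNReal.log (innerProb P
      (pathIn (fun ω (s : unitCube d) =>
        (empiricalMeasure Z (N b) (T b) (ε b) ω).real (Set.Icc 0 (s : Fin d → ℝ))) G)) := by
    refine mul_le_mul_of_nonneg_left (ENNReal.log_monotone ?_) (EReal.coe_nonneg.2 hεb.le)
    exact le_iSup₂_of_le (A \ B) (hAm.diff hBm) (le_iSup_of_le hsub le_rfl)
  refine le_trans ?_ hlog
  rw [hPA, ENNReal.log_ofReal_of_pos (Finset.prod_pos fun j _ => hpos j), ← EReal.coe_mul,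
    EReal.coe_le_coe_iff, Real.log_prod fun j _ => (hpos j).ne', Finset.mul_sum]
  calc a = ∑ j : Fin d → Fin K, (-(q * klFun (x j / q)) - (-a - S) * q) := by
        rw [Finset.sum_sub_distrib, Finset.sum_neg_distrib, Finset.sum_const, Finset.card_univ]
        simp only [Fintype.card_pi, Fintype.card_fin, Finset.prod_const, Finset.card_univ,
          nsmul_eq_mul, Nat.cast_pow]
        rw [← hS, hq]
        field_simp
        ring
    _ ≤ _ := Finset.sum_le_sum fun j _ => (hb j).2

/-- Markov's inequality for the exponential of `1 - 2 * t` times the discrete entropy, whose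
expectation factors over the cells. -/
theorem upper_bound [IsProbabilityMeasure P] (h : IsPoissonArray P l Z N rate T ε) (hd : 1 ≤ d)
    {F : Set (BCone d)} (hF : IsClosed F) {a : ℝ≥0} (ha : (a : ℝ≥0∞) < ⨅ g ∈ F, rateI g)
    {a' : ℝ} (ha' : -(a : ℝ) < a') :
    ∀ᶠ b in l, (ε b : EReal) * ENNReal.log (P (pathIn
      (fun ω (s : unitCube d) => (empiricalMeasure Z (N b) (T b) (ε b) ω).real
        (Set.Icc 0 (s : Fin d → ℝ))) F)) ≤ (a' : EReal) := by
  obtain ⟨K, hK, hgrid⟩ := exists_grid_lt_sum_klFun hd hF ha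
  have hK' : (0 : ℝ) < K := by exact_mod_cast hK
  have ha0 : (0 : ℝ) ≤ a := a.2
  set q : ℝ := ((K : ℝ) ^ d)⁻¹ with hq
  have hq0 : 0 < q := by positivity
  -- The loss `t * (2 * a + 5)` uses at most half of the margin `a' + a`; the constants `log R`,
  -- multiplied by the speed, use the other half. The `1 / 2` keeps `1 - 2 * t` nonnegative.
  set t : ℝ := min (1 / 2) ((a' + a) / (2 * (2 * a + 5))) with ht
  have ht0 : 0 < t := lt_min (by norm_num) (div_pos (by linarith) (by positivity))
  have ht1 : 2 * t ≤ 1 := by linarith [min_le_left (1 / 2) ((a' + a) / (2 * (2 * a + 5)))]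
  have ht2 : -((1 - 2 * t) * a) + 5 * t ≤ -a + (a' + a) / 2 := by
    have h1 : t * (2 * (2 * a + 5)) ≤ a' + a := by
      rw [← le_div_iff₀ (by positivity)]
      exact min_le_right _ _
    linarith
  set R : ℝ := (1 - Real.exp (-t))⁻¹ with hR
  have hR0 : 0 < R := inv_pos.2 (sub_pos.2 (Real.exp_lt_one_iff.2 (neg_lt_zero.2 ht0)))
  have hcells : ∀ j : Fin d → Fin K, ∀ᶠ b in l, 0 < cellMean P Z rate T j b ∧
      |Real.log (cellMean P Z rate T j b / (q / ε b))| ≤ t ∧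
      |q / ε b - cellMean P Z rate T j b| ≤ t * (q / ε b) := by
    intro j
    have h1 := (h.tendsto_cellMean hK j).div_const q
    rw [← hq, div_self hq0.ne'] at h1
    have h2 := (h1.log one_ne_zero).abs
    rw [Real.log_one, abs_zero] at h2
    have h3 := (h1.const_sub 1).abs
    rw [sub_self, abs_zero] at h3
    filter_upwards [h.speed.eventually eventually_mem_nhdsWithin, h1.eventually_const_lt one_pos,
      h2.eventually_le_const ht0, h3.eventually_le_const ht0] with b hb p1 p2 p3
    have hb : 0 < ε b := hb
    have e1 : (cellMean P Z rate T j b : ℝ) / (q / ε b) = ε b * cellMean P Z rate T j b / q := by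
      field_simp
    refine ⟨?_, ?_, ?_⟩
    · have p4 : 0 < ε b * cellMean P Z rate T j b := (div_pos_iff_of_pos_right hq0).1 p1
      have p5 : (0 : ℝ) < cellMean P Z rate T j b := pos_of_mul_pos_right p4 hb.le
      exact_mod_cast p5
    · rwa [e1]
    · have e2 : q / ε b - cellMean P Z rate T j b =
          (1 - ε b * cellMean P Z rate T j b / q) * (q / ε b) := by field_simp
      rw [e2, abs_mul, abs_of_pos (div_pos hq0 hb)]
      gcongr
  have hsmall : ∀ᶠ b in l, ε b * ((K : ℝ) ^ d * Real.log R) ≤ (a' + a) / 2 := by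
    have h1 := (tendsto_nhds_of_tendsto_nhdsWithin h.speed).mul_const ((K : ℝ) ^ d * Real.log R)
    rw [zero_mul] at h1
    exact h1.eventually_le_const (by linarith)
  filter_upwards [eventually_all.2 hcells, h.speed.eventually eventually_mem_nhdsWithin, hsmall]
    with b hb hεb hsm
  have hεb : 0 < ε b := hεb
  set M : ℝ := q / ε b with hM
  have hM0 : 0 < M := div_pos hq0 hεb
  set u : ℕ → ℝ≥0∞ := fun k => ENNReal.ofReal (Real.exp ((1 - 2 * t) * (M * klFun (k / M))))
    with hu
  set C : (Fin d → Fin K) → Set E := fun j => T b ⁻¹' gridCell K j with hC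
  have hCm := h.measurableSet_preimage_gridCell b (K := K)
  -- A path in `F` has discrete entropy above `a`, which in terms of counts reads `∑ j, M * klFun
  -- (count / M) > a / ε b`.
  have hsub : pathIn (fun ω (s : unitCube d) => (empiricalMeasure Z (N b) (T b) (ε b) ω).real
      (Set.Icc 0 (s : Fin d → ℝ))) F ⊆
      {ω | ENNReal.ofReal (Real.exp ((1 - 2 * t) * (a / ε b))) ≤
        ∏ j, u (sampleCount Z (N b) (C j) ω)} := by
    rintro ω ⟨g, hg, hgω⟩
    have h1 := hgrid (empiricalMeasure Z (N b) (T b) (ε b) ω) g hg hgω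
    have e1 : ∀ j : Fin d → Fin K,
        q * klFun ((empiricalMeasure Z (N b) (T b) (ε b) ω).real (gridCell K j) / q) =
          ε b * (M * klFun (sampleCount Z (N b) (C j) ω / M)) := by
      intro j
      rw [empiricalMeasure_real_eq_sampleCount hεb.le ω (measurableSet_gridCell j), ← mul_assoc]
      have e2 : ε b * M = q := by rw [hM]; field_simp
      have e3 : ∀ y : ℝ, ε b * y / q = y / M := fun y => by rw [hM]; field_simp
      rw [e2, e3]
    simp only [e1] at h1
    rw [← Finset.mul_sum, mul_comm, ← div_lt_iff₀ hεb] at h1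
    change ENNReal.ofReal _ ≤ ∏ j, ENNReal.ofReal _
    rw [← ENNReal.ofReal_prod_of_nonneg fun j _ => Real.exp_nonneg _, ← Real.exp_sum,
      ← Finset.mul_sum]
    refine ENNReal.ofReal_le_ofReal (Real.exp_le_exp.2 ?_)
    exact mul_le_mul_of_nonneg_left h1.le (by linarith)
  have hprod : ∫⁻ ω, ∏ j, u (sampleCount Z (N b) (C j) ω) ∂P ≤
      ENNReal.ofReal ((Real.exp (5 * t * M) * R) ^ (K ^ d)) := by
    rw [lintegral_prod_sampleCount h.measurable_sample h.iIndepFun_sample h.identDistrib_sample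
        (h.measurable_size b) (h.law_size b) (h.indepFun b) hCm
        (pairwise_disjoint_preimage_gridCell _ _), ENNReal.ofReal_pow (by positivity)]
    refine (Finset.prod_le_prod' fun j _ => lintegral_exp_klFun_poissonMeasure_le (hb j).1 hM0 ht0
      (hb j).2.1 (hb j).2.2).trans_eq ?_
    simp [hR]
  have hmeas : Measurable fun ω => ∏ j, u (sampleCount Z (N b) (C j) ω) :=
    Finset.measurable_prod _ fun j _ => (Measurable.of_discrete (f := u)).comp
      (measurable_sampleCount h.measurable_sample (h.measurable_size b) (hCm j))
  have hP : P (pathIn (fun ω (s : unitCube d) => (empiricalMeasure Z (N b) (T b) (ε b) ω).real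
      (Set.Icc 0 (s : Fin d → ℝ))) F) ≤
      ENNReal.ofReal ((Real.exp (5 * t * M) * R) ^ (K ^ d) /
        Real.exp ((1 - 2 * t) * (a / ε b))) := by
    rw [ENNReal.ofReal_div_of_pos (Real.exp_pos _)]
    refine (measure_mono hsub).trans ((meas_ge_le_lintegral_div hmeas.aemeasurable ?_
      ENNReal.ofReal_ne_top).trans (ENNReal.div_le_div_right hprod _))
    exact (ENNReal.ofReal_pos.2 (Real.exp_pos _)).ne'
  have hpos : 0 < (Real.exp (5 * t * M) * R) ^ (K ^ d) / Real.exp ((1 - 2 * t) * (a / ε b)) := by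
    positivity
  refine (mul_le_mul_of_nonneg_left (ENNReal.log_monotone hP) (EReal.coe_nonneg.2 hεb.le)).trans ?_
  rw [ENNReal.log_ofReal_of_pos hpos, ← EReal.coe_mul, EReal.coe_le_coe_iff,
    Real.log_div (by positivity) (Real.exp_ne_zero _), Real.log_pow,
    Real.log_mul (Real.exp_ne_zero _) hR0.ne', Real.log_exp, Real.log_exp, Nat.cast_pow]
  have e1 : ε b * ((K : ℝ) ^ d * (5 * t * M + Real.log R) - (1 - 2 * t) * (a / ε b)) =
      -((1 - 2 * t) * a) + 5 * t + ε b * ((K : ℝ) ^ d * Real.log R) := by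
    rw [hM, hq]
    field_simp
    ring
  rw [e1]
  linarith

end IsPoissonArray

end PoissonArray

/-! ### Application to the Poissonized increments. -/

theorem poissonIncrement_eq_empiricalMeasure {Ω : Type*} [MeasurableSpace Ω] {d : ℕ}
    (Z : ℕ → Ω → Fin d → ℝ) (N : Ω → ℕ) (f : (Fin d → ℝ) → ℝ) (c : ℝ) (n : ℕ) (z : Fin d → ℝ)
    (h : ℝ) (hε : 0 ≤ 1 / (c * f z * Real.log n)) :
    poissonIncrement Z N f c n z h = fun ω (s : unitCube d) =>
      (empiricalMeasure Z N (rescale z (h ^ (1 / (d : ℝ)))) (1 / (c * f z * Real.log n)) ω).real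
        (Set.Icc 0 (s : Fin d → ℝ)) := by
  ext ω s
  rw [empiricalMeasure_real_apply hε ω measurableSet_Icc, poissonIncrement, div_eq_mul_one_div,
    mul_comm]
  rfl

theorem rescale_eq_zero_iff {d : ℕ} {z v : Fin d → ℝ} {r : ℝ} (hr : r ≠ 0) :
    rescale z r v = 0 ↔ v = z := by
  rw [rescale, smul_eq_zero_iff_right (inv_ne_zero hr), sub_eq_zero]

/-- Limits along this filter on pairs `(n, i)` are limits in `n` uniform over the row, so one
application of the array bounds handles the minimum and the maximum over `i`. -/
theorem eventually_comap_fst_iff {m : ℕ → ℕ} {p : (n : ℕ) → Fin (m n) → Prop} :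
    (∀ᶠ q in comap (Sigma.fst : (Σ n, Fin (m n)) → ℕ) atTop, p q.1 q.2) ↔
      ∀ᶠ n in atTop, ∀ i, p n i := by
  rw [eventually_comap]
  refine eventually_congr (Eventually.of_forall fun n => ⟨fun h i => h ⟨n, i⟩ rfl, ?_⟩)
  rintro h ⟨n', i⟩ rfl
  exact h i

theorem proposition3p1
    {Ω : Type*} [MeasurableSpace Ω] (P : Measure Ω) [IsProbabilityMeasure P]
    (d : ℕ) (hd : 1 ≤ d)
    -- the sample is i.i.d. and has density `f` on the open set `O`
    (Z : ℕ → Ω → Fin d → ℝ) (hZ : ∀ j, Measurable (Z j)) (hZindep : iIndepFun Z P)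
    (hZident : ∀ j, IdentDistrib (Z j) (Z 0) P P)
    (O : Set (Fin d → ℝ)) (hO : IsOpen O) (f : (Fin d → ℝ) → ℝ)
    (hdens : (P.map (Z 0)).restrict O =
      (volume.restrict O).withDensity (fun x => ENNReal.ofReal (f x)))
    (hfcont : ContinuousOn f O) (hfpos : ∀ x ∈ O, 0 < f x)
    -- the Poisson variables
    (η : ℕ → Ω → ℕ) (hη : ∀ n, Measurable (η n))
    (hηlaw : ∀ n, P.map (η n) = poissonMeasure (n : ℝ≥0))
    (hηindep : ∀ n, IndepFun (η n) (fun ω j => Z j ω) P)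
    -- the compact set
    (H : Set (Fin d → ℝ)) (hH : IsCompact H) (hHO : H ⊆ O) (hHint : (interior H).Nonempty)
    -- the bandwidths
    (c : ℝ) (hc : 0 < c) (h : ℕ → ℝ)
    (hh01 : ∀ n, 1 ≤ n → 0 < h n ∧ h n < 1)
    (hhanti : AntitoneOn h (Set.Ici 1)) (hhlim : Tendsto h atTop (𝓝 0))
    (hnhmono : MonotoneOn (fun n : ℕ => (n : ℝ) * h n) (Set.Ici 1))
    (hnhlim : Tendsto (fun n : ℕ => (n : ℝ) * h n) atTop atTop)
    (hc_lim : Tendsto (fun n : ℕ => (n : ℝ) * h n / Real.log n) atTop (𝓝 c))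
    -- the triangular array of points of `H`
    (m : ℕ → ℕ) (z : (n : ℕ) → Fin (m n) → Fin d → ℝ) (hz : ∀ n i, z n i ∈ H) :
    ULDP P m (fun n i => poissonIncrement Z (η n) f c n (z n i) (h n))
      (fun n i => 1 / (c * f (z n i) * Real.log n)) (rateI (d := d)) := by
  have hpm : IsProbabilityMeasure (P.map (Z 0)) :=
    Measure.isProbabilityMeasure_map (hZ 0).aemeasurable
  obtain ⟨hspeed, hmean⟩ := tendsto_speed_and_mean hd hO hdens hfcont hfpos hH hHO hc
    (fun n hn => (hh01 n hn).1) hhlim hc_lim hz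
  have hε0 : ∀ n i, 0 ≤ 1 / (c * f (z n i) * Real.log n) := fun n i => by
    have := hfpos _ (hHO (hz n i))
    have := Real.log_natCast_nonneg n
    positivity
  have hX := fun n i => poissonIncrement_eq_empiricalMeasure Z (η n) f c n (z n i) (h n) (hε0 n i)
  have hpoint : ∀ n i k, P {ω | Z k ω = z n i} = 0 := fun n i k => by
    have h1 := measure_singleton_eq_zero_of_density hd hdens (hHO (hz n i))
    rw [← (hZident k).map_eq, Measure.map_apply (hZ k) (measurableSet_singleton _)] at h1
    exact h1
  have hnull : ∀ n i, 1 ≤ n → ∀ k,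
      P {ω | rescale (z n i) (h n ^ (1 / (d : ℝ))) (Z k ω) = 0} = 0 := fun n i hn k => by
    simp_rw [rescale_eq_zero_iff (Real.rpow_pos_of_pos (hh01 n hn).1 _).ne']
    exact hpoint n i k
  have harr : IsPoissonArray P (comap Sigma.fst atTop) Z (fun p : Σ n, Fin (m n) => η p.1)
      (fun p => (p.1 : ℝ≥0)) (fun p => rescale (z p.1 p.2) (h p.1 ^ (1 / (d : ℝ))))
      (fun p => 1 / (c * f (z p.1 p.2) * Real.log p.1)) :=
    { measurable_sample := hZ
      iIndepFun_sample := hZindep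
      identDistrib_sample := hZident
      measurable_size := fun p => hη p.1
      law_size := fun p => hηlaw p.1
      indepFun := fun p => hηindep p.1
      measurable_coord := fun p => measurable_rescale _ _
      speed := hspeed
      mean := hmean
      null := eventually_comap_fst_iff.2
        ((eventually_ge_atTop 1).mono fun n hn i => hnull n i hn) }
  refine ⟨isRateFunction_rateI d, fun δ hδ => ?_, fun n i => ?_, fun G hG => ?_, fun F hF => ?_⟩
  · exact eventually_comap_fst_iff.1 ((hspeed.eventually eventually_mem_nhdsWithin).and
      ((tendsto_nhds_of_tendsto_nhdsWithin hspeed).eventually_lt_const hδ))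
  · simp only [hX]
    have hae : ∀ᵐ ω ∂P, empiricalMeasure Z (η n) (rescale (z n i) (h n ^ (1 / (d : ℝ))))
        (1 / (c * f (z n i) * Real.log n)) ω {0} = 0 := by
      -- Nothing is known about `h 0`, but `Real.log 0 = 0` makes the speed, hence the empirical
      -- measure, vanish at `n = 0`.
      rcases Nat.eq_zero_or_pos n with rfl | hn
      · simp [empiricalMeasure]
      · filter_upwards [ae_all_iff.2 fun k => measure_eq_zero_iff_ae_notMem.1 (hnull n i hn k)]
          with ω hω
        exact empiricalMeasure_singleton_eq_zero hω
    filter_upwards [hae] with ω hω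
    obtain ⟨g, hg⟩ := exists_BCone_eq_measureReal _ hω
    exact ⟨g, trivial, hg⟩
  · simp only [hX]
    refine EReal.ge_of_forall_gt_iff_ge.1 fun a ha => ?_
    rw [EReal.lt_neg_comm, ← EReal.coe_neg] at ha
    have ha0 : 0 ≤ -a := EReal.coe_nonneg.1 ((EReal.coe_ennreal_nonneg _).trans ha.le)
    rw [← max_eq_left ha0, ← EReal.coe_ennreal_ofReal, EReal.coe_ennreal_lt_coe_ennreal_iff] at ha
    simp only [iInf_lt_iff] at ha
    obtain ⟨g, hg, hlt⟩ := ha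
    obtain ⟨φ, hφ, hφa, -⟩ := exists_isLebesgueDerivative_of_rateI_lt hlt
    have := ENNReal.toReal_lt_of_lt_ofReal hφa
    refine le_liminf_of_le (by isBoundedDefault) ?_
    exact (eventually_comap_fst_iff.1 (harr.lower_bound hG hg hφ hφa.ne_top
      (by linarith))).mono fun n hn => le_iInf hn
  · simp only [hX]
    refine EReal.le_of_forall_lt_iff_le.1 fun a ha => ?_
    -- Levels `a ≥ 0` are trivial because log-probabilities are nonpositive.
    rcases le_or_gt 0 a with ha0 | ha0
    · refine limsup_le_of_le (by isBoundedDefault) (Eventually.of_forall fun n => iSup_le fun i => ?_)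
      refine le_trans (mul_le_mul_of_nonneg_left (ENNReal.log_le_zero_iff.2 prob_le_one)
        (EReal.coe_nonneg.2 (hε0 n i))) ?_
      rw [mul_zero]
      exact EReal.coe_nonneg.2 ha0
    · rw [EReal.neg_lt_comm, ← EReal.coe_neg, ← max_eq_left (neg_pos.2 ha0).le,
        ← EReal.coe_ennreal_ofReal, EReal.coe_ennreal_lt_coe_ennreal_iff] at ha
      obtain ⟨r, hr1, hr2⟩ := ENNReal.lt_iff_exists_nnreal_btwn.1 ha
      rw [← ENNReal.ofReal_coe_nnreal, ENNReal.ofReal_lt_ofReal_iff_of_nonneg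
        (neg_pos.2 ha0).le] at hr1
      refine limsup_le_of_le (by isBoundedDefault) ?_
      exact (eventually_comap_fst_iff.1 (harr.upper_bound hd hF hr2
        (by linarith))).mono fun n hn => iSup_le hn
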